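/- Let $V\subset\mathbb R^n$ be a domain of positivity with positive definite characteristic: $V$ is a non-empty open set for which there is a (non-singular) symmetric positive definite matrix $S$ such that $V$ is maximal, with respect to inclusion, among the subsets $D$ of $\mathbb R^n$ with the property that $y^tSx>0$ for all $x\in D$ and all $y\in\overline D$, $y\neq0$. Assume that $V$ is homogeneous, i.e. the invertible linear maps $A$ of $\mathbb R^n$ with $AV=V$ act transitively on $V$. Let $$V^*=\{x\in\mathbb R^n : x\cdot y>0\ \text{for all } y\in\overline V,\ y\ne 0\}$$ be the dual cone. Let $\langle 0,x\rangle=\{t\in V: x-t\in V\}$ and let $\Delta_V(x)$ be the Lebesgue measure of $\langle 0,x\rangle$ for $x\in V$. Put $$\sigma_0(V)=\inf\Big\{\alpha\in\mathbb R:\int_{V\cap S^{n-1}}\Delta_V^{\alpha}(t)\,dt<\infty\Big\}\in[-\infty,\infty),\qquad \sigma(V)=\max\{-1,\sigma_0(V)\},$$ where $dt$ is the surface measure of the unit sphere $S^{n-1}$, and define $\sigma(V^*)$ in the same way from $V^*$ and $\Delta_{V^*}$. For $r\ge1$ and measurable $f:V\to[0,\infty]$ let $$R_rf(x)=\frac1{\Gamma(r)}\int_{\langle0,x\rangle}\Delta_V^{r-1}(x-t)f(t)\,dt,\qquad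 x\in V.$$ For $1\le p<\infty$ put $1/p'=1-1/p$. Let $r\geq 1$. Below, "bounded with a constant $c$" means that there is a finite constant $c$, independent of $f$, such that the inequality holds for all measurable $f:V\to[0,\infty]$. (1) If $1\le p\le q<\infty$, $\gamma\in\mathbb R$ and $\gamma<-\sigma(V)\,q/p'-\sigma(V^*)+q(1/p-r+1)-2$, then $R_r$ is bounded with a constant $c$ in the sense that $$\Big(\int_V\Delta_V^{\gamma-q}(x)\,(R_rf(x))^q\,dx\Big)^{1/q}\le c\Big(\int_V f^p(x)\,\Delta_V^{(r-1)p+(\gamma+1)p/q-1}(x)\,dx\Big)^{1/p}.$$ (2) If $1\le p<\infty$, $\alpha\in\mathbb R$ and $\alpha<2-(1+\sigma(V))/p'-r$, then, with a constant $c$, $$\operatorname*{ess\,sup}_{x\in V}\Big(\Delta_V^{-1+\alpha}(x)\,R_r(f\Delta_V^{-\alpha})(x)\Big)\le c\Big(\int_V f^p(x)\,\Delta_V^{(r-1)p-1}(x)\,dx\Big)^{1/p}.$$ (3) If $\alpha\in\mathbb R$ and $\alpha<1-r-\sigma(V)$, then, with a constant $c$, $$\operatorname*{ess\,sup}_{x\in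 V}\Big(\Delta_V^{-1+\alpha}(x)\,R_r(f\Delta_V^{-\alpha})(x)\Big)\le c\operatorname*{ess\,sup}_{x\in V}\Big(f(x)\,\Delta_V^{r-1}(x)\Big).$$ In particular, for $r=1$ the operator $R_1$ is Hardy's operator $Hf(x)=\int_{\langle0,x\rangle}f(t)\,dt$, and (1) is an $n$-dimensional Hardy inequality: if $1\le p\le q<\infty$ and $\gamma<-\sigma(V)\,q/p'-\sigma(V^*)+q/p-2$, then, with a constant $c$, $$\Big(\int_V\Delta_V^{\gamma-q}(x)\,(Hf(x))^q\,dx\Big)^{1/q}\le c\Big(\int_V f^p(x)\,\Delta_V^{(\gamma+1)p/q-1}(x)\,dx\Big)^{1/p}.$$ -/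

import Mathlib

open MeasureTheory
open scoped ENNReal NNReal Matrix

namespace ConeRL

/-- `ℝⁿ` with the Euclidean norm, inner product and Lebesgue measure. -/
abbrev E (n : ℕ) : Type := EuclideanSpace ℝ (Fin n)

/-- The bilinear form `yᵗ S x`. -/
def form {n : ℕ} (S : Matrix (Fin n) (Fin n) ℝ) (y x : E n) : ℝ :=
  y.ofLp ⬝ᵥ (S *ᵥ x.ofLp)

/-- The positivity property `yᵗ S x > 0` for all `x ∈ D` and all `y ∈ closure D`, `y ≠ 0`. -/
def IsFormPositive {n : ℕ} (S : Matrix (Fin n) (Fin n) ℝ) (D : Set (E n)) : Prop :=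
  ∀ x ∈ D, ∀ y ∈ closure D, y ≠ 0 → 0 < form S y x

/-- `D` is a domain of positivity with characteristic `S`: `S` is a non-singular symmetric matrix
and `D` is a non-empty open set which is maximal (for inclusion, among all subsets of `ℝⁿ`) with
the property that `yᵗ S x > 0` for all `x ∈ D` and all nonzero `y ∈ closure D`. -/
structure IsDomainOfPositivity {n : ℕ} (D : Set (E n)) (S : Matrix (Fin n) (Fin n) ℝ) : Prop where
  isOpen : IsOpen D
  nonempty : D.Nonempty
  symm : S.IsSymm
  nonsingular : S.det ≠ 0
  maximal : Maximal (IsFormPositive S) D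

/-- The linear automorphisms of `V`, i.e. the invertible linear maps which map `V` onto `V`. -/
def automorphisms {n : ℕ} (V : Set (E n)) : Set (E n ≃ₗ[ℝ] E n) :=
  {A | A '' V = V}

/-- `V` is homogeneous: its linear automorphisms act transitively on it. -/
def IsHomogeneous {n : ℕ} (V : Set (E n)) : Prop :=
  ∀ x ∈ V, ∀ y ∈ V, ∃ A ∈ automorphisms V, A x = y

/-- The (open) dual cone `V* = {x : x · y > 0 for every nonzero y ∈ closure V}`. -/
def dualCone {n : ℕ} (V : Set (E n)) : Set (E n) :=
  {x | ∀ y ∈ closure V, y ≠ 0 → 0 < inner ℝ x y}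

/-- The ordering of `V`: `x < y` iff `y - x ∈ V`. -/
def coneLT {n : ℕ} (V : Set (E n)) (x y : E n) : Prop := y - x ∈ V

/-- The cone interval `⟨a, b⟩ = {x ∈ V : a < x < b}`. -/
def coneInterval {n : ℕ} (V : Set (E n)) (a b : E n) : Set (E n) :=
  {x | x ∈ V ∧ coneLT V a x ∧ coneLT V x b}

/-- `Δ_V(x)`, the Lebesgue measure of the cone interval `⟨0, x⟩`. -/
noncomputable def coneDelta {n : ℕ} (V : Set (E n)) (x : E n) : ℝ≥0∞ :=
  volume (coneInterval V 0 x)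

/-- The set of real `α` for which the integral of `Δ_V ^ α` over `V ∩ S^{n-1}`, with respect to
the surface measure of the unit sphere, is finite. -/
def sigmaSet {n : ℕ} (V : Set (E n)) : Set ℝ :=
  {α | ∫⁻ t in {t : Metric.sphere (0 : E n) 1 | (t : E n) ∈ V},
      coneDelta V (t : E n) ^ α ∂(volume : Measure (E n)).toSphere < ∞}

/-- `σ₀(V)`, the infimum of `sigmaSet V` in the extended reals (it is `-∞` if `n = 1`). -/
noncomputable def sigmaZero {n : ℕ} (V : Set (E n)) : EReal :=
  sInf ((fun α : ℝ => (α : EReal)) '' sigmaSet V)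

/-- `σ(V) = max {-1, σ₀(V)}`. -/
noncomputable def sigma {n : ℕ} (V : Set (E n)) : ℝ :=
  (max ((-1 : ℝ) : EReal) (sigmaZero V)).toReal

/-- The Riemann-Liouville operator
`R_r f (x) = Γ(r)⁻¹ ∫_{⟨0, x⟩} Δ_V(x - t) ^ (r - 1) f(t) dt` on functions with values in
`[0, ∞]`. -/
noncomputable def riemannLiouville {n : ℕ} (V : Set (E n)) (r : ℝ) (f : E n → ℝ≥0∞) (x : E n) :
    ℝ≥0∞ :=
  ENNReal.ofReal (1 / Real.Gamma r) *
    ∫⁻ t in coneInterval V 0 x, coneDelta V (x - t) ^ (r - 1) * f t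

/-- Hardy's operator `H f (x) = ∫_{⟨0, x⟩} f(t) dt`. -/
noncomputable def hardy {n : ℕ} (V : Set (E n)) (f : E n → ℝ≥0∞) (x : E n) : ℝ≥0∞ :=
  ∫⁻ t in coneInterval V 0 x, f t

end ConeRL

namespace ConeRL

variable {n : ℕ} {V : Set (E n)} {S : Matrix (Fin n) (Fin n) ℝ}

/-! An automorphism `A` of `V` multiplies `Δ_V` by `|det A|`. Since `V` is homogeneous, any function
on `V` that picks up the factor `|det A| ^ κ` under `A` is a constant times `Δ_V ^ κ`. Two integrals
are thereby known up to a constant, which is finite as soon as it is finite at one point: `∫ Δ_V ^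
α` over `⟨0, x⟩` is `c Δ_V(x) ^ (α + 1)`, finite for `α > σ(V)` by polar coordinates
(`exists_setLIntegral_coneInterval_le`), and `∫ Δ_V ^ β` over `V ∩ (t + V)` is `c Δ_V(t) ^ (β + 1)`,
finite for `β < -2 - σ(V*)` by a duality argument (`exists_setLIntegral_above_le`).

The Hardy inequality is then a Schur-type test with power weights. Hölder with a weight `Δ_V ^ (-a)`
uses the first integral and reduces exponent `p` to exponent `1` (`exists_hardy_rpow_le`). Jensen
with exponent `q / p` and Tonelli use the second (`exists_setLIntegral_hardy_rpow_le`). The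
condition on `γ` is exactly what lets one weight serve both steps. For `r ≥ 1` the kernel is at most
`Δ_V(x) ^ (r - 1)`, so `R_r` is dominated by a power of `Δ_V` times Hardy's operator. The two
supremum bounds need only the first integral. -/

/-! ### Linear changes of variable -/

theorem setLIntegral_image_linearEquiv (A : E n ≃ₗ[ℝ] E n) {s : Set (E n)} (hs : MeasurableSet s)
    (g : E n → ℝ≥0∞) :
    ∫⁻ y in A '' s, g y
      = ENNReal.ofReal |LinearMap.det (A : E n →ₗ[ℝ] E n)| * ∫⁻ x in s, g (A x) := by
  have h := lintegral_image_eq_lintegral_abs_det_fderiv_mul (volume : Measure (E n)) hs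
    (f := A) (f' := fun _ => LinearMap.toContinuousLinearMap (A : E n →ₗ[ℝ] E n))
    (fun x _ => (LinearMap.toContinuousLinearMap (A : E n →ₗ[ℝ] E n)).hasFDerivWithinAt)
    A.injective.injOn g
  rw [h, lintegral_const_mul' _ _ ENNReal.ofReal_ne_top]
  rfl

theorem mem_coneInterval_zero {V : Set (E n)} {x t : E n} :
    t ∈ coneInterval V 0 x ↔ t ∈ V ∧ x - t ∈ V := by
  simp [coneInterval, coneLT]

theorem coneInterval_image (A : E n ≃ₗ[ℝ] E n) (V : Set (E n)) (x : E n) :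
    coneInterval (A '' V) 0 (A x) = A '' coneInterval V 0 x := by
  ext t
  simp only [mem_coneInterval_zero, Set.mem_image]
  constructor
  · rintro ⟨⟨u, hu, rfl⟩, v, hv, h⟩
    refine ⟨u, ⟨hu, ?_⟩, rfl⟩
    rw [← map_sub] at h
    rwa [← A.injective h]
  · rintro ⟨u, hu, rfl⟩
    exact ⟨⟨u, hu.1, rfl⟩, _, hu.2, map_sub _ _ _⟩

theorem coneDelta_image (A : E n ≃ₗ[ℝ] E n) (V : Set (E n)) (x : E n) :
    coneDelta (A '' V) (A x)
      = ENNReal.ofReal |LinearMap.det (A : E n →ₗ[ℝ] E n)| * coneDelta V x := by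
  rw [coneDelta, coneInterval_image]
  exact Measure.addHaar_image_linearMap volume (A : E n →ₗ[ℝ] E n) _

theorem ofReal_abs_det_ne_zero (A : E n ≃ₗ[ℝ] E n) :
    ENNReal.ofReal |LinearMap.det (A : E n →ₗ[ℝ] E n)| ≠ 0 := by
  simpa using A.isUnit_det'.ne_zero

/-! ### Proper cones and integrability near the origin -/

/-- Open convex cones in which the intervals `⟨0, x⟩` have size comparable to `‖x‖`. -/
structure IsProperCone (W : Set (E n)) : Prop where
  isOpen : IsOpen W
  add_mem : ∀ x ∈ W, ∀ y ∈ W, x + y ∈ W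
  smul_mem : ∀ c : ℝ, 0 < c → ∀ x ∈ W, c • x ∈ W
  bounded : ∃ K : ℝ, ∀ x, ∀ t ∈ coneInterval W 0 x, ‖t‖ ≤ K * ‖x‖

theorem IsProperCone.image {W : Set (E n)} (hW : IsProperCone W) (A : E n ≃ₗ[ℝ] E n) :
    IsProperCone (A '' W) where
  isOpen := by
    rw [← LinearEquiv.coe_toContinuousLinearEquiv' A]
    exact A.toContinuousLinearEquiv.isOpenMap _ hW.isOpen
  add_mem := by
    rintro _ ⟨x, hx, rfl⟩ _ ⟨y, hy, rfl⟩
    exact ⟨x + y, hW.add_mem x hx y hy, map_add _ _ _⟩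
  smul_mem := by
    rintro c hc _ ⟨x, hx, rfl⟩
    exact ⟨c • x, hW.smul_mem c hc x hx, map_smul _ _ _⟩
  bounded := by
    obtain ⟨K, hK⟩ := hW.bounded
    set A' : E n →L[ℝ] E n := (A.toContinuousLinearEquiv : E n →L[ℝ] E n)
    set A'' : E n →L[ℝ] E n := (A.symm.toContinuousLinearEquiv : E n →L[ℝ] E n)
    refine ⟨‖A'‖ * |K| * ‖A''‖, fun x t ht => ?_⟩
    obtain ⟨x, rfl⟩ := A.surjective x
    rw [coneInterval_image] at ht
    obtain ⟨u, hu, rfl⟩ := ht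
    have h1 : ‖A u‖ ≤ ‖A'‖ * ‖u‖ := A'.le_opNorm u
    have h2 : ‖x‖ ≤ ‖A''‖ * ‖A x‖ := by simpa [A''] using A''.le_opNorm (A x)
    have h3 : ‖u‖ ≤ |K| * ‖x‖ := (hK x u hu).trans (by gcongr; exact le_abs_self K)
    calc ‖A u‖ ≤ ‖A'‖ * (|K| * (‖A''‖ * ‖A x‖)) := h1.trans (by gcongr; exact h3.trans (by gcongr))
      _ = _ := by ring

theorem isOpen_coneInterval {W : Set (E n)} (hW : IsOpen W) (x : E n) :
    IsOpen (coneInterval W 0 x) := by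
  have : coneInterval W 0 x = W ∩ (fun t => x - t) ⁻¹' W := by
    ext t; simp [mem_coneInterval_zero]
  rw [this]
  exact hW.inter (hW.preimage (by fun_prop))

theorem measurable_coneDelta {W : Set (E n)} (hW : IsOpen W) : Measurable (coneDelta W) := by
  have : MeasurableSet {p : E n × E n | p.2 ∈ W ∧ p.1 - p.2 ∈ W} :=
    ((hW.preimage continuous_snd).inter (hW.preimage (by fun_prop))).measurableSet
  have h : coneDelta W = fun x => volume (Prod.mk x ⁻¹' {p : E n × E n | p.2 ∈ W ∧ p.1 - p.2 ∈ W}) := by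
    funext x
    rw [coneDelta]
    congr 1
    ext t
    simp [mem_coneInterval_zero]
  rw [h]
  exact measurable_measure_prodMk_left this

/-- The radial factor in polar coordinates: `volumeIoiPow m` has density `r ^ m`, so the integrand
is `r ^ (m + β)` on `(0, R]`. -/
theorem lintegral_volumeIoiPow_lt_top {m : ℕ} {β : ℝ} (hβ : -1 < m + β) (R : ℝ) :
    ∫⁻ r : Set.Ioi (0 : ℝ), (Set.Iic R).indicator (fun r => ENNReal.ofReal (r ^ β)) (r : ℝ)
      ∂(Measure.volumeIoiPow m) < ∞ := by
  have hm : Measurable ((Set.Iic R).indicator (fun r : ℝ => ENNReal.ofReal (r ^ β))) :=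
    Measurable.indicator (by fun_prop) measurableSet_Iic
  have hd : Measurable fun r : Set.Ioi (0 : ℝ) => ENNReal.ofReal ((r : ℝ) ^ m) := by fun_prop
  have key : ∫⁻ r : Set.Ioi (0 : ℝ), (Set.Iic R).indicator (fun r => ENNReal.ofReal (r ^ β)) (r : ℝ)
      ∂(Measure.volumeIoiPow m) = ∫⁻ r in Set.Ioi (0 : ℝ), ENNReal.ofReal (r ^ m) *
        (Set.Iic R).indicator (fun r => ENNReal.ofReal (r ^ β)) r :=
    (lintegral_withDensity_eq_lintegral_mul _ hd (hm.comp measurable_subtype_coe)).trans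
      (lintegral_subtype_comap measurableSet_Ioi (fun r : ℝ => ENNReal.ofReal (r ^ m) *
        (Set.Iic R).indicator (fun r => ENNReal.ofReal (r ^ β)) r))
  rw [key]
  have h : ∫⁻ r in Set.Ioc 0 R, ENNReal.ofReal (r ^ ((m : ℝ) + β)) < ∞ := by
    rcases le_total R 0 with hR | hR
    · simp [Set.Ioc_eq_empty_of_le hR]
    · have := (intervalIntegral.intervalIntegrable_rpow' (a := 0) (b := R) hβ).1
      exact this.lintegral_lt_top
  refine lt_of_le_of_lt (le_of_eq ?_) h
  rw [← Set.Ioi_inter_Iic, Set.inter_comm, ← setLIntegral_indicator measurableSet_Iic]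
  refine setLIntegral_congr_fun measurableSet_Ioi fun r (hr : 0 < r) => ?_
  by_cases hrR : r ∈ Set.Iic R
  · simp only [Set.indicator_of_mem hrR]
    rw [← ENNReal.ofReal_mul (by positivity), Real.rpow_add hr, Real.rpow_natCast]
  · simp only [Set.indicator_of_notMem hrR, mul_zero]

theorem IsProperCone.coneDelta_smul {W : Set (E n)} (hW : IsProperCone W) {c : ℝ} (hc : 0 < c)
    (x : E n) : coneDelta W (c • x) = ENNReal.ofReal (c ^ n) * coneDelta W x := by
  set A : E n ≃ₗ[ℝ] E n := LinearEquiv.smulOfNeZero ℝ (E n) c hc.ne'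
  have hA : A '' W = W := by
    ext y
    constructor
    · rintro ⟨x, hx, rfl⟩
      exact hW.smul_mem c hc x hx
    · intro hy
      exact ⟨c⁻¹ • y, hW.smul_mem _ (inv_pos.2 hc) y hy, smul_inv_smul₀ hc.ne' y⟩
  have hdet : LinearMap.det (A : E n →ₗ[ℝ] E n) = c ^ n := by
    have : (A : E n →ₗ[ℝ] E n) = c • LinearMap.id := by ext; rfl
    rw [this, LinearMap.det_smul]; simp
  have h := coneDelta_image A W x
  rw [hA, hdet, abs_of_pos (by positivity)] at h
  exact h

theorem IsProperCone.coneDelta_pos {W : Set (E n)} (hW : IsProperCone W) {x : E n} (hx : x ∈ W) :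
    coneDelta W x ≠ 0 := by
  refine ((isOpen_coneInterval hW.isOpen x).measure_pos volume ⟨(1 / 2 : ℝ) • x, ?_⟩).ne'
  have h := hW.smul_mem (1 / 2) (by norm_num) x hx
  refine mem_coneInterval_zero.2 ⟨h, ?_⟩
  convert h using 1
  module

theorem IsProperCone.exists_coneDelta_le {W : Set (E n)} (hW : IsProperCone W) (R : ℝ) :
    ∃ M : ℝ≥0, ∀ x, ‖x‖ ≤ R → coneDelta W x ≤ M := by
  obtain ⟨K, hK⟩ := hW.bounded
  have hfin : volume (Metric.closedBall (0 : E n) (|K| * R)) ≠ ∞ := measure_closedBall_lt_top.ne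
  refine ⟨(volume (Metric.closedBall (0 : E n) (|K| * R))).toNNReal, fun x hx => ?_⟩
  rw [ENNReal.coe_toNNReal hfin]
  refine measure_mono fun t ht => ?_
  rw [mem_closedBall_zero_iff]
  calc ‖t‖ ≤ K * ‖x‖ := hK x t ht
    _ ≤ |K| * ‖x‖ := by gcongr; exact le_abs_self K
    _ ≤ _ := by gcongr

theorem IsProperCone.coneDelta_ne_top {W : Set (E n)} (hW : IsProperCone W) (x : E n) :
    coneDelta W x ≠ ∞ := by
  obtain ⟨M, hM⟩ := hW.exists_coneDelta_le ‖x‖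
  exact ((hM x le_rfl).trans_lt ENNReal.coe_lt_top).ne

theorem IsProperCone.coneDelta_mono {W : Set (E n)} (hW : IsProperCone W) {x t : E n}
    (h : x - t ∈ W) : coneDelta W t ≤ coneDelta W x := by
  refine measure_mono fun u hu => ?_
  rw [mem_coneInterval_zero] at hu ⊢
  refine ⟨hu.1, ?_⟩
  have := hW.add_mem _ h _ hu.2
  rwa [sub_add_sub_cancel] at this

/-- `Δ_W` is bounded on the unit sphere, so raising the exponent preserves integrability and
`sigmaSet W` is an upper set. -/
theorem IsProperCone.mem_sigmaSet {W : Set (E n)} (hW : IsProperCone W) {α : ℝ}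
    (hα : sigma W < α) : -1 < α ∧ α ∈ sigmaSet W := by
  -- The sphere has finite measure, so `σ₀ ≤ 0`. Hence the maximum with `-1` is a real number and
  -- `toReal` does not return its default value.
  have h0 : (0 : ℝ) ∈ sigmaSet W := by
    simp only [sigmaSet, Set.mem_ofPred_eq, ENNReal.rpow_zero]
    simp
  have hle : sigmaZero W ≤ (0 : ℝ) := sInf_le ⟨0, h0, rfl⟩
  have hcoe : ((sigma W : ℝ) : EReal) = max ((-1 : ℝ) : EReal) (sigmaZero W) := by
    refine EReal.coe_toReal ?_ ?_
    · exact (lt_of_le_of_lt (max_le (by norm_cast) hle) (EReal.coe_lt_top 0)).ne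
    · exact (lt_of_lt_of_le (EReal.bot_lt_coe (-1)) (le_max_left _ _)).ne'
  have hα' : max ((-1 : ℝ) : EReal) (sigmaZero W) < α := by
    rw [← hcoe]; exact_mod_cast hα
  rw [max_lt_iff] at hα'
  refine ⟨by exact_mod_cast hα'.1, ?_⟩
  obtain ⟨_, ⟨β, hβ, rfl⟩, hβα⟩ := sInf_lt_iff.1 hα'.2
  have hβα : β < α := EReal.coe_lt_coe_iff.1 hβα
  obtain ⟨M, hM⟩ := hW.exists_coneDelta_le 1
  have hmeas : MeasurableSet {t : Metric.sphere (0 : E n) 1 | (t : E n) ∈ W} :=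
    (hW.isOpen.preimage continuous_subtype_val).measurableSet
  have hle : ∀ t : Metric.sphere (0 : E n) 1, (t : E n) ∈ W →
      coneDelta W (t : E n) ^ α ≤ (M : ℝ≥0∞) ^ (α - β) * coneDelta W (t : E n) ^ β := by
    intro t ht
    have : coneDelta W (t : E n) ^ α
        = coneDelta W (t : E n) ^ (α - β) * coneDelta W (t : E n) ^ β := by
      rw [← ENNReal.rpow_add _ _ (hW.coneDelta_pos ht) (hW.coneDelta_ne_top _)]
      congr 1; ring
    rw [this]
    gcongr ?_ * _
    exact ENNReal.rpow_le_rpow (hM _ (by simp)) (by linarith)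
  refine lt_of_le_of_lt (setLIntegral_mono' hmeas hle) ?_
  have hfin : (M : ℝ≥0∞) ^ (α - β) ≠ ∞ :=
    ENNReal.rpow_ne_top_of_nonneg (by linarith) ENNReal.coe_ne_top
  rw [lintegral_const_mul' _ _ hfin]
  exact ENNReal.mul_lt_top hfin.lt_top hβ

/-- Powers of `Δ_W` with an exponent above `σ(W)` are integrable near the origin. -/
theorem IsProperCone.setLIntegral_closedBall_lt_top {W : Set (E n)} (hW : IsProperCone W) {α : ℝ}
    (hα : sigma W < α) (R : ℝ) :
    ∫⁻ x in W ∩ Metric.closedBall 0 R, coneDelta W x ^ α < ∞ := by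
  obtain ⟨hα1, hαs⟩ := hW.mem_sigmaSet hα
  have hWm := hW.isOpen.measurableSet
  -- In dimension `0` the origin is not a null set and polar coordinates fail; there `W` is empty or
  -- the single point `0`.
  rcases Nat.eq_zero_or_pos n with rfl | hn
  · have hfin : volume (W ∩ Metric.closedBall 0 R) < ∞ :=
      (measure_mono Set.inter_subset_right).trans_lt measure_closedBall_lt_top
    by_cases h0 : (0 : E 0) ∈ W
    · have : ∀ x : E 0, coneDelta W x ^ α = coneDelta W 0 ^ α := fun x => by
        rw [Subsingleton.elim x 0]
      simp only [this, lintegral_const, Measure.restrict_apply_univ]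
      exact ENNReal.mul_lt_top (ENNReal.rpow_ne_top_of_ne_zero (hW.coneDelta_pos h0)
        (hW.coneDelta_ne_top 0)).lt_top hfin
    · have : W = ∅ := by
        ext x; rw [Subsingleton.elim x 0]; simpa using h0
      simp [this]
  have : Nonempty (Fin n) := ⟨⟨0, hn⟩⟩
  have hdim : Module.finrank ℝ (E n) = n := by simp
  set F : E n → ℝ≥0∞ := (W ∩ Metric.closedBall 0 R).indicator fun x => coneDelta W x ^ α
  have hF : ∫⁻ x in W ∩ Metric.closedBall 0 R, coneDelta W x ^ α = ∫⁻ x, F x :=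
    (lintegral_indicator (hWm.inter Metric.isClosed_closedBall.measurableSet) _).symm
  have hmp := (volume : Measure (E n)).measurePreserving_homeomorphUnitSphereProd
  rw [hdim] at hmp
  have hpol : ∫⁻ x, F x = ∫⁻ p, F ((p.2 : ℝ) • (p.1 : E n))
      ∂((volume : Measure (E n)).toSphere.prod (Measure.volumeIoiPow (n - 1))) := by
    rw [← hmp.lintegral_comp_emb (Homeomorph.measurableEmbedding _)]
    conv_lhs => rw [← restrict_compl_singleton (μ := (volume : Measure (E n))) 0,
      ← lintegral_subtype_comap (measurableSet_singleton _).compl]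
    refine lintegral_congr fun x => ?_
    congr 1
    exact congrArg Subtype.val ((homeomorphUnitSphereProd (E n)).symm_apply_apply x).symm
  set G : Metric.sphere (0 : E n) 1 → ℝ≥0∞ :=
    Set.indicator {t : Metric.sphere (0 : E n) 1 | (t : E n) ∈ W}
      fun t => coneDelta W (t : E n) ^ α
  have hGm : MeasurableSet {t : Metric.sphere (0 : E n) 1 | (t : E n) ∈ W} :=
    (hW.isOpen.preimage continuous_subtype_val).measurableSet
  have hle : ∀ p : Metric.sphere (0 : E n) 1 × Set.Ioi (0 : ℝ),
      F ((p.2 : ℝ) • (p.1 : E n)) ≤ G p.1 *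
        (Set.Iic R).indicator (fun r => ENNReal.ofReal (r ^ (n * α))) (p.2 : ℝ) := by
    rintro ⟨s, r, hr : 0 < r⟩
    by_cases h : r • (s : E n) ∈ W ∩ Metric.closedBall 0 R
    · have hs : (s : E n) ∈ W := by
        simpa [smul_smul, hr.ne'] using hW.smul_mem r⁻¹ (inv_pos.2 hr) _ h.1
      have hrR : r ∈ Set.Iic R := by
        simpa [norm_smul, abs_of_pos hr] using h.2
      simp only [F, G, Set.indicator_of_mem h, Set.indicator_of_mem hrR]
      rw [Set.indicator_of_mem (show s ∈ {t : Metric.sphere (0 : E n) 1 | (t : E n) ∈ W} from hs),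
        hW.coneDelta_smul hr, ENNReal.mul_rpow_of_ne_top ENNReal.ofReal_ne_top
          (hW.coneDelta_ne_top _), ENNReal.ofReal_rpow_of_pos (by positivity), mul_comm,
        Real.rpow_mul hr.le, Real.rpow_natCast]
    · simp [F, Set.indicator_of_notMem h]
  rw [hF, hpol]
  refine (lintegral_mono hle).trans_lt ?_
  have hGm' : AEMeasurable G (volume : Measure (E n)).toSphere :=
    ((((measurable_coneDelta hW.isOpen).comp measurable_subtype_coe).pow_const α).indicator
      hGm).aemeasurable
  have hpm : AEMeasurable (fun r : Set.Ioi (0 : ℝ) =>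
      (Set.Iic R).indicator (fun r => ENNReal.ofReal (r ^ (n * α))) (r : ℝ))
      (Measure.volumeIoiPow (n - 1)) := by
    have hm : Measurable ((Set.Iic R).indicator fun r : ℝ => ENNReal.ofReal (r ^ (n * α))) :=
      Measurable.indicator (by fun_prop) measurableSet_Iic
    exact (hm.comp measurable_subtype_coe).aemeasurable
  rw [lintegral_prod_mul hGm' hpm]
  refine ENNReal.mul_lt_top ?_ (lintegral_volumeIoiPow_lt_top ?_ R)
  · rw [lintegral_indicator hGm]
    exact hαs
  -- The radial exponent is `n - 1 + nα`, which exceeds `-1` exactly when `α > -1`: the reason for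
  -- the truncation in `σ`.
  · rw [Nat.cast_pred hn]
    have : (0 : ℝ) < n := by exact_mod_cast hn
    nlinarith

/-! ### Domains of positivity: cone structure and self-duality -/

theorem form_eq_inner (S : Matrix (Fin n) (Fin n) ℝ) (y x : E n) :
    form S y x = inner ℝ y (Matrix.toEuclideanLin S x) := by
  rw [EuclideanSpace.inner_eq_star_dotProduct, form, dotProduct_comm]
  simp

theorem form_comm (hS : S.IsSymm) (x y : E n) : form S y x = form S x y := by
  rw [form, form, Matrix.dotProduct_mulVec, ← Matrix.mulVec_transpose, hS.eq, dotProduct_comm]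

theorem form_self_pos (hS : S.PosDef) {x : E n} (hx : x ≠ 0) : 0 < form S x x := by
  have := hS.dotProduct_mulVec_pos (x := x.ofLp) (by simpa using hx)
  simpa [form] using this

theorem form_add_right (S : Matrix (Fin n) (Fin n) ℝ) (y x z : E n) :
    form S y (x + z) = form S y x + form S y z := by
  simp [form_eq_inner, inner_add_right]

theorem form_sub_right (S : Matrix (Fin n) (Fin n) ℝ) (y x z : E n) :
    form S y (x - z) = form S y x - form S y z := by
  simp [form_eq_inner, inner_sub_right]

theorem form_smul_right (S : Matrix (Fin n) (Fin n) ℝ) (c : ℝ) (y x : E n) :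
    form S y (c • x) = c * form S y x := by
  simp [form_eq_inner, inner_smul_right]

theorem form_smul_left (S : Matrix (Fin n) (Fin n) ℝ) (c : ℝ) (y x : E n) :
    form S (c • y) x = c * form S y x := by
  simp [form_eq_inner, inner_smul_left]

theorem continuous_form (S : Matrix (Fin n) (Fin n) ℝ) :
    Continuous fun p : E n × E n => form S p.2 p.1 := by
  simp only [form_eq_inner]
  have : Continuous (Matrix.toEuclideanLin S) := LinearMap.continuous_of_finiteDimensional _
  fun_prop

/-- Self-duality from maximality: adjoining such an `x` to `V` keeps the positivity property.
Positive definiteness is what settles the new pair `(x, x)`. -/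
theorem IsDomainOfPositivity.mem_iff (hV : IsDomainOfPositivity V S) (hS : S.PosDef) {x : E n} :
    x ∈ V ↔ ∀ y ∈ closure V, y ≠ 0 → 0 < form S y x := by
  refine ⟨fun hx => hV.maximal.prop x hx, fun hx => ?_⟩
  rcases eq_or_ne x 0 with rfl | hx0
  · obtain ⟨e, he⟩ := hV.nonempty
    by_contra h
    have := hx e (subset_closure he) (fun h0 => h (h0 ▸ he))
    simp [form] at this
  -- If `0` lay in the open set `V`, so would a small nonzero multiple of `x`, and its form with `0`
  -- is not positive.
  have h0 : (0 : E n) ∉ V := by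
    intro h0
    have hc : Filter.Tendsto (fun c : ℝ => c • x) (nhdsWithin 0 {0}ᶜ) (nhds 0) := by
      have : Continuous fun c : ℝ => c • x := by fun_prop
      simpa using (this.tendsto 0).mono_left nhdsWithin_le_nhds
    obtain ⟨c, hcV, hc0⟩ := ((hc.eventually (hV.isOpen.mem_nhds h0)).and
      self_mem_nhdsWithin).exists
    have := hV.maximal.prop 0 h0 (c • x) (subset_closure hcV) (smul_ne_zero hc0 hx0)
    simp [form] at this
  have hP : IsFormPositive S (insert x V) := by
    intro z hz y hy hy0
    rw [← Set.singleton_union, closure_union, closure_singleton] at hy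
    rcases hz with rfl | hz
    · rcases hy with rfl | hy
      · exact form_self_pos hS hx0
      · exact hx y hy hy0
    · rcases hy with rfl | hy
      · rw [form_comm hV.symm]
        exact hx z (subset_closure hz) (fun h => h0 (h ▸ hz))
      · exact hV.maximal.prop z hz y hy hy0
  exact hV.maximal.le_of_ge hP (Set.subset_insert x V) (Set.mem_insert x V)

theorem IsDomainOfPositivity.form_nonneg (hV : IsDomainOfPositivity V S) {x y : E n}
    (hx : x ∈ V) (hy : y ∈ closure V) : 0 ≤ form S y x := by
  rcases eq_or_ne y 0 with rfl | h
  · simp [form]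
  · exact (hV.maximal.prop x hx y hy h).le

theorem IsDomainOfPositivity.smul_mem (hV : IsDomainOfPositivity V S) (hS : S.PosDef) {c : ℝ}
    (hc : 0 < c) {x : E n} (hx : x ∈ V) : c • x ∈ V := by
  rw [hV.mem_iff hS] at hx ⊢
  intro y hy hy0
  rw [form_smul_right]
  exact mul_pos hc (hx y hy hy0)

/-- Compactness of `closure V ∩ S^{n-1}` gives a positive minimum, which scales to the whole closed
cone. -/
theorem IsDomainOfPositivity.exists_le_form (hV : IsDomainOfPositivity V S) (hS : S.PosDef)
    {x : E n} (hx : x ∈ V) : ∃ c : ℝ, 0 < c ∧ ∀ y ∈ closure V, c * ‖y‖ ≤ form S y x := by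
  have hcont : Continuous fun y : E n => form S y x :=
    (continuous_form S).comp (by fun_prop : Continuous fun y : E n => (x, y))
  have hcomp : IsCompact (closure V ∩ Metric.sphere (0 : E n) 1) :=
    (isCompact_sphere 0 1).inter_left isClosed_closure
  have hsmul : ∀ c : ℝ, 0 < c → ∀ y ∈ closure V, c • y ∈ closure V := fun c hc y hy =>
    map_mem_closure (f := fun y : E n => c • y) (by fun_prop) hy
      (fun z hz => hV.smul_mem hS hc hz)
  obtain ⟨c, hc, hmin⟩ : ∃ c : ℝ, 0 < c ∧ ∀ y ∈ closure V ∩ Metric.sphere (0 : E n) 1,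
      c ≤ form S y x := by
    rcases (closure V ∩ Metric.sphere (0 : E n) 1).eq_empty_or_nonempty with h | h
    · exact ⟨1, one_pos, by simp [h]⟩
    · obtain ⟨y, hy, hmin⟩ := hcomp.exists_isMinOn h hcont.continuousOn
      refine ⟨form S y x, hV.maximal.prop x hx y hy.1 ?_, fun z hz => hmin hz⟩
      rintro rfl
      simpa using hy.2
  refine ⟨c, hc, fun y hy => ?_⟩
  rcases eq_or_ne y 0 with rfl | hy0
  · simp [form]
  have hpos : 0 < ‖y‖ := norm_pos_iff.2 hy0
  have := hmin (‖y‖⁻¹ • y) ⟨hsmul _ (inv_pos.2 hpos) y hy, by simp [norm_smul, hpos.ne']⟩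
  rw [form_smul_left, le_inv_mul_iff₀ hpos] at this
  linarith

theorem IsDomainOfPositivity.isProperCone (hV : IsDomainOfPositivity V S) (hS : S.PosDef) :
    IsProperCone V where
  isOpen := hV.isOpen
  add_mem x hx y hy := by
    rw [hV.mem_iff hS] at hx ⊢
    intro z hz hz0
    rw [form_add_right]
    exact add_pos_of_pos_of_nonneg (hx z hz hz0) (hV.form_nonneg hy hz)
  smul_mem c hc x hx := hV.smul_mem hS hc hx
  bounded := by
    obtain ⟨e, he⟩ := hV.nonempty
    obtain ⟨c, hc, hle⟩ := hV.exists_le_form hS he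
    -- The chain is `c ‖t‖ ≤ form S t e ≤ form S x e ≤ ‖x‖ ‖S e‖`, with `x - t ∈ V` used in the
    -- middle.
    refine ⟨‖Matrix.toEuclideanLin S e‖ / c, fun x t ht => ?_⟩
    rw [mem_coneInterval_zero] at ht
    have h1 := hle t (subset_closure ht.1)
    have h2 : 0 ≤ form S e (x - t) := by
      rw [form_comm hV.symm]
      exact hV.form_nonneg he (subset_closure ht.2)
    rw [form_sub_right, form_comm hV.symm, form_comm hV.symm t] at h2
    have h3 : form S x e ≤ ‖x‖ * ‖Matrix.toEuclideanLin S e‖ := by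
      rw [form_eq_inner]; exact real_inner_le_norm _ _
    rw [div_mul_eq_mul_div, le_div_iff₀ hc]
    linarith

/-- A positive definite matrix as a linear automorphism of `ℝⁿ`. -/
noncomputable def posDefEquiv (hS : S.PosDef) : E n ≃ₗ[ℝ] E n :=
  LinearEquiv.ofInjectiveEndo (Matrix.toEuclideanLin S) <| by
    rw [← LinearMap.ker_eq_bot, LinearMap.ker_eq_bot']
    intro x hx
    by_contra h
    have := form_self_pos hS h
    rw [form_eq_inner, hx, inner_zero_right] at this
    exact this.false

theorem form_eq_inner_posDefEquiv (hS : S.PosDef) (y x : E n) :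
    form S y x = inner ℝ y (posDefEquiv hS x) :=
  form_eq_inner S y x

theorem IsDomainOfPositivity.dualCone_eq (hV : IsDomainOfPositivity V S) (hS : S.PosDef) :
    dualCone V = posDefEquiv hS '' V := by
  ext x
  obtain ⟨x, rfl⟩ := (posDefEquiv hS).surjective x
  rw [(posDefEquiv hS).injective.mem_set_image, hV.mem_iff hS]
  simp only [dualCone, Set.mem_ofPred_eq, form_eq_inner_posDefEquiv hS, real_inner_comm]

theorem det_adjoint (A : E n →ₗ[ℝ] E n) : LinearMap.det (LinearMap.adjoint A) = LinearMap.det A := by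
  set b := EuclideanSpace.basisFun (Fin n) ℝ
  rw [← LinearMap.det_toMatrix b.toBasis, ← LinearMap.det_toMatrix b.toBasis A,
    LinearMap.toMatrix_adjoint b b, Matrix.det_conjTranspose]
  simp

/-- `B` is the inverse of the adjoint `L` of `A` for the form `S`. Self-duality makes `L` preserve
`V`, and `det L = det A`. -/
theorem IsDomainOfPositivity.exists_adjoint (hV : IsDomainOfPositivity V S) (hS : S.PosDef)
    {A : E n ≃ₗ[ℝ] E n} (hA : A ∈ automorphisms V) :
    ∃ B ∈ automorphisms V, |LinearMap.det (B : E n →ₗ[ℝ] E n)|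
        = |LinearMap.det (A : E n →ₗ[ℝ] E n)|⁻¹ ∧
      ∀ x y, form S (B y) (A x) = form S y x := by
  set T := posDefEquiv hS
  set L : E n →ₗ[ℝ] E n := (T.symm : E n →ₗ[ℝ] E n) ∘ₗ
    LinearMap.adjoint (A : E n →ₗ[ℝ] E n) ∘ₗ (T : E n →ₗ[ℝ] E n)
  have hL : ∀ x y, form S (A x) y = form S x (L y) := by
    intro x y
    simp only [form_eq_inner_posDefEquiv hS, L, T, LinearMap.comp_apply, LinearEquiv.coe_coe,
      LinearEquiv.apply_symm_apply, LinearMap.adjoint_inner_right]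
  have hLdet : LinearMap.det L = LinearMap.det (A : E n →ₗ[ℝ] E n) := by
    rw [← det_adjoint (A : E n →ₗ[ℝ] E n)]
    exact LinearMap.det_conj (LinearMap.adjoint (A : E n →ₗ[ℝ] E n)) T.symm
  set L' : E n ≃ₗ[ℝ] E n := LinearEquiv.ofIsUnitDet (f := L) (v := Module.finBasis ℝ (E n))
    (v' := Module.finBasis ℝ (E n)) (by rw [LinearMap.det_toMatrix, hLdet]; exact A.isUnit_det')
  have hL' : ∀ x, L' x = L x := fun _ => rfl
  have hA' : A '' V = V := hA
  have hAcl : A '' closure V = closure V := by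
    conv_rhs => rw [← hA']
    exact (A.toContinuousLinearEquiv.toHomeomorph.image_closure V)
  have hmem : ∀ y, L' y ∈ V ↔ y ∈ V := by
    intro y
    rw [hV.mem_iff hS, hV.mem_iff hS]
    constructor
    · intro h z hz hz0
      rw [← hAcl] at hz
      obtain ⟨w, hw, rfl⟩ := hz
      rw [hL]
      exact h w hw (fun h0 => hz0 (by rw [h0, map_zero]))
    · intro h z hz hz0
      rw [hL', ← hL]
      exact h _ (hAcl ▸ Set.mem_image_of_mem A hz) (by simpa using hz0)
  refine ⟨L'.symm, ?_, ?_, ?_⟩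
  · change L'.symm '' V = V
    ext y
    obtain ⟨y, rfl⟩ := L'.symm.surjective y
    rw [L'.symm.injective.mem_set_image, ← hmem (L'.symm y), LinearEquiv.apply_symm_apply]
  · have : LinearMap.det (L' : E n →ₗ[ℝ] E n) = LinearMap.det L := rfl
    rw [LinearEquiv.det_coe_symm, this, hLdet, abs_inv]
  · intro x y
    rw [form_comm hV.symm, hL, ← hL', LinearEquiv.apply_symm_apply, form_comm hV.symm]

/-! ### Relatively invariant functions and the integral over `⟨0, x⟩` -/

theorem coneDelta_automorphism {A : E n ≃ₗ[ℝ] E n} (hA : A ∈ automorphisms V) (x : E n) :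
    coneDelta V (A x) = ENNReal.ofReal |LinearMap.det (A : E n →ₗ[ℝ] E n)| * coneDelta V x := by
  have hA' : A '' V = V := hA
  have := coneDelta_image A V x
  rwa [hA'] at this

theorem coneDelta_rpow_automorphism (hV : IsProperCone V) {A : E n ≃ₗ[ℝ] E n}
    (hA : A ∈ automorphisms V) (x : E n) (α : ℝ) :
    coneDelta V (A x) ^ α
      = ENNReal.ofReal |LinearMap.det (A : E n →ₗ[ℝ] E n)| ^ α * coneDelta V x ^ α := by
  rw [coneDelta_automorphism hA, ENNReal.mul_rpow_of_ne_top ENNReal.ofReal_ne_top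
    (hV.coneDelta_ne_top x)]

theorem mem_of_mem_automorphisms {A : E n ≃ₗ[ℝ] E n} (hA : A ∈ automorphisms V) (x : E n) :
    A x ∈ V ↔ x ∈ V := by
  have hA' : A '' V = V := hA
  conv_lhs => rw [← hA']
  exact A.injective.mem_set_image

/-- A function which is relatively invariant under the automorphisms of a homogeneous cone is a
multiple of a power of `Δ_V`. -/
theorem eq_mul_coneDelta_rpow (hV : IsProperCone V) (hhom : IsHomogeneous V) {F : E n → ℝ≥0∞}
    {κ : ℝ} (hF : ∀ A ∈ automorphisms V, ∀ x ∈ V,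
      F (A x) = ENNReal.ofReal |LinearMap.det (A : E n →ₗ[ℝ] E n)| ^ κ * F x)
    {e x : E n} (he : e ∈ V) (hx : x ∈ V) :
    F x = F e * coneDelta V e ^ (-κ) * coneDelta V x ^ κ := by
  obtain ⟨A, hA, rfl⟩ := hhom e he x hx
  have h1 : coneDelta V e ^ (-κ) * coneDelta V e ^ κ = 1 := by
    rw [← ENNReal.rpow_add _ _ (hV.coneDelta_pos he) (hV.coneDelta_ne_top e)]
    simp
  rw [hF A hA e he, coneDelta_rpow_automorphism hV hA]
  calc _ = ENNReal.ofReal |LinearMap.det (A : E n →ₗ[ℝ] E n)| ^ κ * F e * 1 := by rw [mul_one]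
    _ = _ := by rw [← h1]; ring

theorem exists_le_coneDelta_rpow (hV : IsProperCone V) (hhom : IsHomogeneous V)
    {F : E n → ℝ≥0∞} {κ : ℝ} (hF : ∀ A ∈ automorphisms V, ∀ x ∈ V,
      F (A x) = ENNReal.ofReal |LinearMap.det (A : E n →ₗ[ℝ] E n)| ^ κ * F x)
    {e : E n} (he : e ∈ V) (hfin : F e < ∞) :
    ∃ c : ℝ≥0, ∀ x ∈ V, F x ≤ c * coneDelta V x ^ κ := by
  have hc : F e * coneDelta V e ^ (-κ) ≠ ∞ := ENNReal.mul_ne_top hfin.ne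
    (ENNReal.rpow_ne_top_of_ne_zero (hV.coneDelta_pos he) (hV.coneDelta_ne_top e))
  refine ⟨(F e * coneDelta V e ^ (-κ)).toNNReal, fun x hx => ?_⟩
  rw [ENNReal.coe_toNNReal hc]
  exact (eq_mul_coneDelta_rpow hV hhom hF he hx).le

theorem setLIntegral_coneDelta_rpow_image (hV : IsProperCone V) {A : E n ≃ₗ[ℝ] E n}
    (hA : A ∈ automorphisms V) {s : Set (E n)} (hs : MeasurableSet s) (α : ℝ) :
    ∫⁻ y in A '' s, coneDelta V y ^ α
      = ENNReal.ofReal |LinearMap.det (A : E n →ₗ[ℝ] E n)| ^ (α + 1)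
        * ∫⁻ x in s, coneDelta V x ^ α := by
  rw [setLIntegral_image_linearEquiv A hs]
  simp only [coneDelta_rpow_automorphism hV hA]
  rw [lintegral_const_mul' _ _ (ENNReal.rpow_ne_top_of_ne_zero (ofReal_abs_det_ne_zero A)
    ENNReal.ofReal_ne_top), ENNReal.rpow_add _ _ (ofReal_abs_det_ne_zero A) ENNReal.ofReal_ne_top,
    ENNReal.rpow_one]
  ring

/-- The integral is relatively invariant; the Jacobian adds `1` to the exponent. It is finite at one
point because `⟨0, e⟩` is a bounded part of `V`. -/
theorem exists_setLIntegral_coneInterval_le (hV : IsProperCone V) (hhom : IsHomogeneous V)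
    (hne : V.Nonempty) {α : ℝ} (hα : sigma V < α) :
    ∃ c : ℝ≥0, ∀ x ∈ V,
      ∫⁻ t in coneInterval V 0 x, coneDelta V t ^ α ≤ c * coneDelta V x ^ (α + 1) := by
  obtain ⟨e, he⟩ := hne
  refine exists_le_coneDelta_rpow hV hhom (κ := α + 1) ?_ he ?_
  · intro A hA x _
    have hA' : A '' V = V := hA
    rw [← setLIntegral_coneDelta_rpow_image hV hA (isOpen_coneInterval hV.isOpen x).measurableSet,
      ← coneInterval_image, hA']
  · obtain ⟨K, hK⟩ := hV.bounded
    refine lt_of_le_of_lt (lintegral_mono_set fun t ht => ?_)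
      (hV.setLIntegral_closedBall_lt_top hα (K * ‖e‖))
    exact ⟨ht.1, by simpa using hK e t ht⟩

/-! ### The integral over `V ∩ (t + V)` -/

/-- `V*` is the image of `V` under `S`, and integrability on bounded parts is invariant under linear
maps, so `σ(V*)` also controls `V`. -/
theorem IsDomainOfPositivity.setLIntegral_closedBall_lt_top (hV : IsDomainOfPositivity V S)
    (hS : S.PosDef) {α : ℝ} (hα : sigma (dualCone V) < α) (R : ℝ) :
    ∫⁻ x in V ∩ Metric.closedBall 0 R, coneDelta V x ^ α < ∞ := by
  have hP := hV.isProperCone hS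
  set T := posDefEquiv hS
  set d := ENNReal.ofReal |LinearMap.det (T : E n →ₗ[ℝ] E n)|
  have hd0 : d ≠ 0 := ofReal_abs_det_ne_zero T
  rw [hV.dualCone_eq hS] at hα
  set T' : E n →L[ℝ] E n := (T.toContinuousLinearEquiv : E n →L[ℝ] E n)
  have h := (hP.image T).setLIntegral_closedBall_lt_top hα (‖T'‖ * R)
  have hsub : T '' (V ∩ Metric.closedBall 0 R) ⊆ T '' V ∩ Metric.closedBall 0 (‖T'‖ * R) := by
    rintro _ ⟨x, ⟨hx, hxR⟩, rfl⟩
    refine ⟨⟨x, hx, rfl⟩, ?_⟩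
    rw [mem_closedBall_zero_iff] at hxR ⊢
    exact (T'.le_opNorm x).trans (by gcongr)
  have h2 := (lintegral_mono_set hsub).trans_lt h
  rw [setLIntegral_image_linearEquiv T
    (hP.isOpen.measurableSet.inter Metric.isClosed_closedBall.measurableSet)] at h2
  simp only [coneDelta_image] at h2
  simp only [ENNReal.mul_rpow_of_ne_top ENNReal.ofReal_ne_top (hP.coneDelta_ne_top _)] at h2
  rw [lintegral_const_mul' _ _ (ENNReal.rpow_ne_top_of_ne_zero hd0 ENNReal.ofReal_ne_top)] at h2
  have h3 := ENNReal.lt_top_of_mul_ne_top_right h2.ne hd0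
  refine ENNReal.lt_top_of_mul_ne_top_right h3.ne ?_
  exact (ENNReal.rpow_pos (pos_iff_ne_zero.2 hd0) ENNReal.ofReal_ne_top).ne'

/-- The part of `V` below the hyperplane `yᵗ S x = 1`. -/
def lowerSection (S : Matrix (Fin n) (Fin n) ℝ) (V : Set (E n)) (x : E n) : Set (E n) :=
  {y | y ∈ V ∧ form S y x < 1}

theorem IsDomainOfPositivity.isOpen_lowerSection (hV : IsDomainOfPositivity V S) (x : E n) :
    IsOpen (lowerSection S V x) := by
  refine hV.isOpen.inter (isOpen_Iio.preimage (f := fun y : E n => form S y x) ?_)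
  exact (continuous_form S).comp (by fun_prop : Continuous fun y : E n => (x, y))

/-- `A` acts on the sections through the dual automorphism `B`, whose determinant is inverse up to
sign; hence the negated exponent. -/
theorem IsDomainOfPositivity.setLIntegral_lowerSection_automorphism
    (hV : IsDomainOfPositivity V S) (hS : S.PosDef) (s : ℝ) {A : E n ≃ₗ[ℝ] E n}
    (hA : A ∈ automorphisms V) (x : E n) :
    ∫⁻ y in lowerSection S V (A x), coneDelta V y ^ s
      = ENNReal.ofReal |LinearMap.det (A : E n →ₗ[ℝ] E n)| ^ (-s - 1)
        * ∫⁻ y in lowerSection S V x, coneDelta V y ^ s := by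
  obtain ⟨B, hB, hdet, hform⟩ := hV.exists_adjoint hS hA
  have himg : lowerSection S V (A x) = B '' lowerSection S V x := by
    ext y
    obtain ⟨y, rfl⟩ := B.surjective y
    rw [B.injective.mem_set_image]
    simp only [lowerSection, Set.mem_ofPred_eq, hform, mem_of_mem_automorphisms hB]
  have hpos : 0 < |LinearMap.det (A : E n →ₗ[ℝ] E n)| := by
    simpa using A.isUnit_det'.ne_zero
  rw [himg, setLIntegral_coneDelta_rpow_image (hV.isProperCone hS) hB
    (hV.isOpen_lowerSection x).measurableSet, hdet, ENNReal.ofReal_inv_of_pos hpos,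
    ENNReal.inv_rpow, ← ENNReal.rpow_neg]
  congr 2
  ring

theorem IsDomainOfPositivity.exists_lowerSection_subset (hV : IsDomainOfPositivity V S)
    (hS : S.PosDef) {x : E n} (hx : x ∈ V) :
    ∃ R : ℝ, lowerSection S V x ⊆ V ∩ Metric.closedBall 0 R := by
  obtain ⟨c, hc, hle⟩ := hV.exists_le_form hS hx
  refine ⟨1 / c, fun y hy => ⟨hy.1, ?_⟩⟩
  rw [mem_closedBall_zero_iff, le_div_iff₀ hc]
  have := hle y (subset_closure hy.1)
  linarith [hy.2]

theorem IsDomainOfPositivity.lowerSection_nonempty (hV : IsDomainOfPositivity V S)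
    (hS : S.PosDef) {x : E n} (hx : x ∈ V) : (lowerSection S V x).Nonempty := by
  have h0 : 0 ≤ form S x x := hV.form_nonneg hx (subset_closure hx)
  have hc : 0 < (1 + form S x x)⁻¹ := by positivity
  refine ⟨(1 + form S x x)⁻¹ • x, hV.smul_mem hS hc hx, ?_⟩
  rw [form_smul_left, inv_mul_lt_iff₀ (by positivity)]
  linarith

/-- By relative invariance only `t = e` needs a finite value. There `Δ_V ^ β` is written as a
multiple of a Laplace-type integral over lower sections, and Tonelli moves the question from
infinity to the origin. -/
theorem IsDomainOfPositivity.exists_setLIntegral_above_le (hV : IsDomainOfPositivity V S)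
    (hS : S.PosDef) (hhom : IsHomogeneous V) {β : ℝ} (hβ : β < -2 - sigma (dualCone V)) :
    ∃ c : ℝ≥0, ∀ t ∈ V, ∫⁻ x in {x | x ∈ V ∧ x - t ∈ V}, coneDelta V x ^ β
      ≤ c * coneDelta V t ^ (β + 1) := by
  have hP := hV.isProperCone hS
  have hVm := hP.isOpen.measurableSet
  have hΔ := measurable_coneDelta hP.isOpen
  have hopen : ∀ t : E n, IsOpen {x | x ∈ V ∧ x - t ∈ V} := fun t =>
    hP.isOpen.inter (hP.isOpen.preimage (by fun_prop))
  obtain ⟨e, he⟩ := hV.nonempty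
  refine exists_le_coneDelta_rpow hP hhom (κ := β + 1) ?_ he ?_
  · intro A hA x _
    rw [← setLIntegral_coneDelta_rpow_image hP hA (hopen x).measurableSet]
    congr 2
    ext y
    obtain ⟨y, rfl⟩ := A.surjective y
    rw [A.injective.mem_set_image]
    simp only [Set.mem_ofPred_eq, ← map_sub, mem_of_mem_automorphisms hA]
  -- Chosen so that `N` is a multiple of `Δ_V ^ (-s - 1) = Δ_V ^ β`.
  set s : ℝ := -β - 1 with hs
  set N : E n → ℝ≥0∞ := fun x => ∫⁻ y in lowerSection S V x, coneDelta V y ^ s with hNdef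
  have hN : ∀ x ∈ V, N x = N e * coneDelta V e ^ (-(-s - 1)) * coneDelta V x ^ (-s - 1) :=
    fun x hx => eq_mul_coneDelta_rpow hP hhom
      (fun A hA x _ => hV.setLIntegral_lowerSection_automorphism hS s hA x) he hx
  -- The exponent `0` bounds the volume of a lower section by `c₀ Δ_V ^ (-1)`.
  obtain ⟨c₀, hc₀⟩ := exists_le_coneDelta_rpow hP hhom
    (F := fun x => ∫⁻ y in lowerSection S V x, coneDelta V y ^ (0 : ℝ))
    (fun A hA x _ => hV.setLIntegral_lowerSection_automorphism hS 0 hA x) he (by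
      obtain ⟨R, hR⟩ := hV.exists_lowerSection_subset hS he
      simp only [ENNReal.rpow_zero, lintegral_const, one_mul, Measure.restrict_apply_univ]
      exact (measure_mono (hR.trans Set.inter_subset_right)).trans_lt measure_closedBall_lt_top)
  -- Only nonvanishing matters: `k * ∫ Δ_V ^ β < ∞` with `k ≠ 0` already bounds the integral.
  have hNe : N e ≠ 0 := by
    have hpos : 0 < volume (lowerSection S V e) :=
      (hV.isOpen_lowerSection e).measure_pos volume (hV.lowerSection_nonempty hS he)
    refine ((setLIntegral_pos_iff (hΔ.pow_const s)).2 (hpos.trans_le (measure_mono ?_))).ne'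
    intro y hy
    refine ⟨?_, hy⟩
    exact (ENNReal.rpow_pos (pos_iff_ne_zero.2 (hP.coneDelta_pos hy.1))
      (hP.coneDelta_ne_top y)).ne'
  set k := N e * coneDelta V e ^ (-(-s - 1))
  have hk : k ≠ 0 := mul_ne_zero hNe (ENNReal.rpow_pos (pos_iff_ne_zero.2 (hP.coneDelta_pos he))
    (hP.coneDelta_ne_top e)).ne'
  have hsβ : -s - 1 = β := by rw [hs]; ring
  have hNint : ∫⁻ x in {x | x ∈ V ∧ x - e ∈ V}, N x < ∞ := by
    set k : E n → E n → ℝ≥0∞ := fun x y =>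
      Set.indicator {p : E n × E n | form S p.2 p.1 < 1} (fun p => coneDelta V p.2 ^ s) (x, y)
    have hset : MeasurableSet {p : E n × E n | form S p.2 p.1 < 1} :=
      (isOpen_Iio.preimage (continuous_form S)).measurableSet
    have hkm : Measurable (Function.uncurry k) :=
      ((hΔ.comp measurable_snd).pow_const s).indicator hset
    have h1 : ∀ x, N x = ∫⁻ y in V, k x y := by
      intro x
      have : k x = Set.indicator {y | form S y x < 1} fun y => coneDelta V y ^ s := by
        funext y; rfl
      have hm : MeasurableSet {y : E n | form S y x < 1} := hset.preimage measurable_prodMk_left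
      have hset' : lowerSection S V x = {y | form S y x < 1} ∩ V := by
        ext y; exact and_comm
      rw [this, setLIntegral_indicator hm, hNdef, ← hset']
    simp only [h1]
    rw [lintegral_lintegral_swap hkm.aemeasurable]
    obtain ⟨R, hR⟩ := hV.exists_lowerSection_subset hS he
    -- For `x - e ∈ V` one has `form S y e ≤ form S y x`, so only `y` in the bounded section at `e`
    -- contribute. By symmetry of the form, `x` then lies in the section at `y`, which costs one
    -- power of `Δ_V(y)`.
    have h2 : ∀ y ∈ V, ∫⁻ x in {x | x ∈ V ∧ x - e ∈ V}, k x y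
        ≤ Set.indicator (lowerSection S V e) (fun y => c₀ * coneDelta V y ^ (s - 1)) y := by
      intro y hy
      have hk' : (fun x => k x y) = Set.indicator {x | form S y x < 1}
          fun _ => coneDelta V y ^ s := by
        funext x; rfl
      have hm : MeasurableSet {x : E n | form S y x < 1} := hset.preimage measurable_prodMk_right
      rw [hk', setLIntegral_indicator hm, setLIntegral_const]
      by_cases hye : y ∈ lowerSection S V e
      · rw [Set.indicator_of_mem hye]
        have h3 := hc₀ y hy
        simp only [ENNReal.rpow_zero, lintegral_const, one_mul, Measure.restrict_apply_univ] at h3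
        calc _ ≤ coneDelta V y ^ s * (c₀ * coneDelta V y ^ (-0 - 1 : ℝ)) := by
              gcongr
              refine (measure_mono ?_).trans h3
              rintro x ⟨hx1, hx2, -⟩
              refine ⟨hx2, ?_⟩
              rw [form_comm hV.symm]; exact hx1
          _ = c₀ * (coneDelta V y ^ s * coneDelta V y ^ (-0 - 1 : ℝ)) := by ring
          _ = _ := by
            rw [← ENNReal.rpow_add _ _ (hP.coneDelta_pos hy) (hP.coneDelta_ne_top y)]
            congr 2; ring
      · have : {x | form S y x < 1} ∩ {x | x ∈ V ∧ x - e ∈ V} = ∅ := by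
          ext x
          simp only [Set.mem_inter_iff, Set.mem_ofPred_eq, Set.mem_empty_iff_false, iff_false]
          rintro ⟨hx1, -, hx2⟩
          refine hye ⟨hy, ?_⟩
          have := hV.form_nonneg hx2 (subset_closure hy)
          rw [form_sub_right] at this
          linarith
        rw [this]
        simp
    refine (setLIntegral_mono' hVm h2).trans_lt ?_
    rw [setLIntegral_indicator (hV.isOpen_lowerSection e).measurableSet,
      lintegral_const_mul' _ _ ENNReal.coe_ne_top]
    refine ENNReal.mul_lt_top ENNReal.coe_lt_top ?_
    exact (lintegral_mono_set (Set.inter_subset_left.trans hR)).trans_lt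
      (hV.setLIntegral_closedBall_lt_top hS (by rw [hs]; linarith) R)
  rw [setLIntegral_congr_fun (hopen e).measurableSet (fun x hx => hN x hx.1),
    lintegral_const_mul'' _ (by fun_prop), hsβ] at hNint
  exact ENNReal.lt_top_of_mul_ne_top_right hNint.ne hk

/-! ### Weighted Hardy inequalities -/

/-- Jensen's inequality for the measure with density `g`, in unnormalised form. -/
theorem lintegral_mul_rpow_le {X : Type*} [MeasurableSpace X] {μ : Measure X} {k : ℝ} (hk : 1 ≤ k)
    {g h : X → ℝ≥0∞} (hg : AEMeasurable g μ) (hh : AEMeasurable h μ) :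
    (∫⁻ x, g x * h x ∂μ) ^ k ≤ (∫⁻ x, g x ∂μ) ^ (k - 1) * ∫⁻ x, g x * h x ^ k ∂μ := by
  rcases hk.eq_or_lt with rfl | hk
  · simp
  have hpq := Real.HolderConjugate.conjExponent hk
  set l := k.conjExponent
  have hk0 : 0 < k := by linarith
  have hl0 : 0 < l := hpq.symm.pos
  have hsum : 1 / k + 1 / l = 1 := by simpa using hpq.inv_add_inv_eq_one
  have hsplit : ∀ x, g x * h x = (g x ^ (1 / k) * h x) * g x ^ (1 / l) := fun x => by
    conv_lhs => rw [← ENNReal.rpow_one (g x), ← hsum,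
      ENNReal.rpow_add_of_nonneg _ _ (by positivity) (by positivity)]
    ring
  have h1 : ∀ x, (g x ^ (1 / k) * h x) ^ k = g x * h x ^ k := fun x => by
    rw [ENNReal.mul_rpow_of_nonneg _ _ hk0.le, ← ENNReal.rpow_mul, one_div_mul_cancel hk0.ne',
      ENNReal.rpow_one]
  have h2 : ∀ x, (g x ^ (1 / l)) ^ l = g x := fun x => by
    rw [← ENNReal.rpow_mul, one_div_mul_cancel hl0.ne', ENNReal.rpow_one]
  have hH := ENNReal.lintegral_mul_le_Lp_mul_Lq μ hpq
    (f := fun x => g x ^ (1 / k) * h x) (g := fun x => g x ^ (1 / l))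
    ((hg.pow_const _).mul hh) (hg.pow_const _)
  simp only [Pi.mul_apply, h1, h2, ← hsplit] at hH
  have hlk : 1 / l * k = k - 1 := by
    have : 1 / l = 1 - 1 / k := by linarith
    rw [this]; field_simp
  calc _ ≤ _ := ENNReal.rpow_le_rpow hH hk0.le
    _ = _ := by
      rw [ENNReal.mul_rpow_of_nonneg _ _ hk0.le, ← ENNReal.rpow_mul, ← ENNReal.rpow_mul,
        one_div_mul_cancel hk0.ne', ENNReal.rpow_one, hlk, mul_comm]

theorem coneInterval_subset (V : Set (E n)) (x : E n) : coneInterval V 0 x ⊆ V :=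
  fun _ ht => ht.1

theorem IsProperCone.rpow_add {W : Set (E n)} (hW : IsProperCone W) {x : E n} (hx : x ∈ W)
    (a b : ℝ) : coneDelta W x ^ a * coneDelta W x ^ b = coneDelta W x ^ (a + b) :=
  (ENNReal.rpow_add a b (hW.coneDelta_pos hx) (hW.coneDelta_ne_top x)).symm

/-- Hölder's inequality for Hardy's operator with a power of `Δ_V` as weight. -/
theorem exists_hardy_rpow_le (hV : IsProperCone V) (hhom : IsHomogeneous V) (hne : V.Nonempty)
    {p δ : ℝ} (hp : 1 ≤ p) (hδ : δ < -sigma V * (1 - 1 / p)) :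
    ∃ c : ℝ≥0, ∀ f : E n → ℝ≥0∞, AEMeasurable f (volume.restrict V) → ∀ x ∈ V,
      hardy V f x ^ p ≤ c * coneDelta V x ^ (p - 1 - δ * p) *
        ∫⁻ t in coneInterval V 0 x, f t ^ p * coneDelta V t ^ (δ * p) := by
  have hΔ := measurable_coneDelta hV.isOpen
  rcases hp.eq_or_lt with rfl | hp
  -- For `p = 1` the conjugate exponent is infinite; monotonicity of `Δ_V` and `-δ > 0` replace
  -- Hölder.
  · refine ⟨1, fun f hf x hx => ?_⟩
    have hδ0 : δ < 0 := by simpa using hδ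
    simp only [ENNReal.rpow_one, mul_one, ENNReal.coe_one, one_mul, sub_self, zero_sub]
    rw [hardy, ← lintegral_const_mul' _ _ (ENNReal.rpow_ne_top_of_ne_zero (hV.coneDelta_pos hx)
      (hV.coneDelta_ne_top x))]
    refine setLIntegral_mono_ae' (isOpen_coneInterval hV.isOpen x).measurableSet
      (Filter.Eventually.of_forall fun t ht => ?_)
    rw [mem_coneInterval_zero] at ht
    calc f t = coneDelta V t ^ (-δ) * (f t * coneDelta V t ^ δ) := by
          rw [mul_left_comm, hV.rpow_add ht.1]; simp
      _ ≤ _ := by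
          gcongr ?_ * _
          exact ENNReal.rpow_le_rpow (hV.coneDelta_mono ht.2) (by linarith)
  have hp0 : 0 < p := by linarith
  have hp1 : 0 < p - 1 := by linarith
  -- This is `δ p'`: the hypothesis on `δ` says exactly that `Δ_V ^ (-a)` has exponent above `σ(V)`.
  set a := δ * p / (p - 1)
  have hap : a * (p - 1) = δ * p := div_mul_cancel₀ _ hp1.ne'
  have ha : sigma V < -a := by
    have h : δ * p < -sigma V * (p - 1) := by
      have := mul_lt_mul_of_pos_right hδ hp0
      have e : -sigma V * (1 - 1 / p) * p = -sigma V * (p - 1) := by field_simp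
      rwa [e] at this
    rw [← hap] at h
    linarith [lt_of_mul_lt_mul_right h hp1.le]
  obtain ⟨c, hc⟩ := exists_setLIntegral_coneInterval_le hV hhom hne ha
  refine ⟨c ^ (p - 1), fun f hf x hx => ?_⟩
  have hm := (isOpen_coneInterval hV.isOpen x).measurableSet
  have hJ := lintegral_mul_rpow_le (μ := volume.restrict (coneInterval V 0 x)) hp.le
    (g := fun t => coneDelta V t ^ (-a)) (h := fun t => f t * coneDelta V t ^ a)
    (hΔ.pow_const _).aemeasurable
    ((hf.mono_set (coneInterval_subset V x)).mul (hΔ.pow_const _).aemeasurable)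
  have h1 : ∫⁻ t in coneInterval V 0 x, coneDelta V t ^ (-a) * (f t * coneDelta V t ^ a)
      = hardy V f x := by
    refine setLIntegral_congr_fun hm fun t ht => ?_
    rw [mul_left_comm, hV.rpow_add ht.1]
    simp
  have h2 : ∫⁻ t in coneInterval V 0 x, coneDelta V t ^ (-a) * (f t * coneDelta V t ^ a) ^ p
      = ∫⁻ t in coneInterval V 0 x, f t ^ p * coneDelta V t ^ (δ * p) := by
    refine setLIntegral_congr_fun hm fun t ht => ?_
    rw [ENNReal.mul_rpow_of_nonneg _ _ hp0.le, mul_left_comm, ← ENNReal.rpow_mul,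
      hV.rpow_add ht.1, ← hap]
    congr 2
    ring
  rw [h1, h2] at hJ
  refine hJ.trans ?_
  gcongr ?_ * _
  calc _ ≤ (c * coneDelta V x ^ (-a + 1)) ^ (p - 1) := ENNReal.rpow_le_rpow (hc x hx) hp1.le
    _ = _ := by
      rw [ENNReal.mul_rpow_of_nonneg _ _ hp1.le, ← ENNReal.rpow_mul,
        ← ENNReal.coe_rpow_of_nonneg _ hp1.le]
      congr 2
      linear_combination -hap

/-- Jensen for the measure `g Δ_V ^ (-η) dt` makes the inner expression linear in `g`. Tonelli then
leaves the integral of `Δ_V ^ (-kη - 1)` above `t`, and the powers of `Δ_V(t)` combine to `-η`. -/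
theorem IsDomainOfPositivity.exists_setLIntegral_hardy_rpow_le (hV : IsDomainOfPositivity V S)
    (hS : S.PosDef) (hhom : IsHomogeneous V) {k η : ℝ} (hk : 1 ≤ k)
    (hη : -k * η - 1 < -2 - sigma (dualCone V)) :
    ∃ c : ℝ≥0, ∀ g : E n → ℝ≥0∞, AEMeasurable g (volume.restrict V) →
      ∫⁻ x in V, coneDelta V x ^ (-k * η - 1) * hardy V g x ^ k
        ≤ c * (∫⁻ t in V, g t * coneDelta V t ^ (-η)) ^ k := by
  have hP := hV.isProperCone hS
  have hVm := hP.isOpen.measurableSet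
  have hΔ := measurable_coneDelta hP.isOpen
  obtain ⟨c, hc⟩ := hV.exists_setLIntegral_above_le hS hhom hη
  refine ⟨c, fun g hg => ?_⟩
  set b := -k * η - 1 with hb
  set A := ∫⁻ t in V, g t * coneDelta V t ^ (-η) with hA
  set G : E n → ℝ≥0∞ := fun t => g t * coneDelta V t ^ (-η + η * k) with hG
  have hGm : AEMeasurable G (volume.restrict V) := hg.mul (hΔ.pow_const _).aemeasurable
  have hstep : ∀ x, hardy V g x ^ k ≤ A ^ (k - 1) * ∫⁻ t in coneInterval V 0 x, G t := by
    intro x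
    have hm := (isOpen_coneInterval hP.isOpen x).measurableSet
    have hJ := lintegral_mul_rpow_le (μ := volume.restrict (coneInterval V 0 x)) hk
      (g := fun t => g t * coneDelta V t ^ (-η)) (h := fun t => coneDelta V t ^ η)
      ((hg.mono_set (coneInterval_subset V x)).mul (hΔ.pow_const _).aemeasurable)
      (hΔ.pow_const _).aemeasurable
    have h1 : ∫⁻ t in coneInterval V 0 x, g t * coneDelta V t ^ (-η) * coneDelta V t ^ η
        = hardy V g x := by
      refine setLIntegral_congr_fun hm fun t ht => ?_
      rw [mul_assoc, hP.rpow_add ht.1]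
      simp
    have h2 : ∫⁻ t in coneInterval V 0 x, g t * coneDelta V t ^ (-η) * (coneDelta V t ^ η) ^ k
        = ∫⁻ t in coneInterval V 0 x, G t := by
      refine setLIntegral_congr_fun hm fun t ht => ?_
      simp only [hG]
      rw [mul_assoc, ← ENNReal.rpow_mul, hP.rpow_add ht.1]
    rw [h1, h2] at hJ
    refine hJ.trans ?_
    gcongr ?_ * _
    exact ENNReal.rpow_le_rpow (lintegral_mono_set (coneInterval_subset V x)) (by linarith)
  set K : E n → E n → ℝ≥0∞ := fun x t =>
    Set.indicator {p : E n × E n | p.1 - p.2 ∈ V} (fun p => coneDelta V p.1 ^ b * G p.2) (x, t)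
    with hK
  have hset : MeasurableSet {p : E n × E n | p.1 - p.2 ∈ V} :=
    (hP.isOpen.preimage (by fun_prop)).measurableSet
  have hKm : AEMeasurable (Function.uncurry K) ((volume.restrict V).prod (volume.restrict V)) :=
    (((hΔ.comp measurable_fst).pow_const b).aemeasurable.mul
      (hGm.comp_quasiMeasurePreserving Measure.quasiMeasurePreserving_snd)).indicator hset
  have hK1 : ∀ x, coneDelta V x ^ b * ∫⁻ t in coneInterval V 0 x, G t = ∫⁻ t in V, K x t := by
    intro x
    have h : K x = Set.indicator {t | x - t ∈ V} fun t => coneDelta V x ^ b * G t := by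
      funext t; rfl
    have hm : MeasurableSet {t : E n | x - t ∈ V} := hset.preimage measurable_prodMk_left
    have hi : {t | x - t ∈ V} ∩ V = coneInterval V 0 x := by
      ext t; rw [mem_coneInterval_zero]; exact and_comm
    rw [h, setLIntegral_indicator hm, hi,
      lintegral_const_mul'' _ (hGm.mono_set (coneInterval_subset V x))]
  have hK2 : ∀ t ∈ V, ∫⁻ x in V, K x t ≤ c * (g t * coneDelta V t ^ (-η)) := by
    intro t ht
    have h : (fun x => K x t) = Set.indicator {x | x - t ∈ V} fun x => coneDelta V x ^ b * G t := by
      funext x; rfl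
    have hm : MeasurableSet {x : E n | x - t ∈ V} := hset.preimage measurable_prodMk_right
    have hi : {x | x - t ∈ V} ∩ V = {x | x ∈ V ∧ x - t ∈ V} := by
      ext x; exact and_comm
    rw [h, setLIntegral_indicator hm, hi, lintegral_mul_const _ (hΔ.pow_const b)]
    calc _ ≤ c * coneDelta V t ^ (b + 1) * G t := by gcongr; exact hc t ht
      _ = c * (g t * (coneDelta V t ^ (b + 1) * coneDelta V t ^ (-η + η * k))) := by
        simp only [hG]; ring
      _ = _ := by
        rw [hP.rpow_add ht, hb]
        congr 3
        ring
  have hKm' : AEMeasurable (fun x => ∫⁻ t in V, K x t) (volume.restrict V) :=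
    hKm.lintegral_prod_right'
  calc ∫⁻ x in V, coneDelta V x ^ b * hardy V g x ^ k
      ≤ ∫⁻ x in V, A ^ (k - 1) * ∫⁻ t in V, K x t := by
        refine lintegral_mono fun x => ?_
        rw [← hK1, mul_left_comm]
        gcongr
        exact hstep x
    _ = A ^ (k - 1) * ∫⁻ t in V, ∫⁻ x in V, K x t := by
        rw [lintegral_const_mul'' _ hKm', lintegral_lintegral_swap hKm]
    _ ≤ A ^ (k - 1) * ∫⁻ t in V, c * (g t * coneDelta V t ^ (-η)) := by
        gcongr A ^ (k - 1) * ?_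
        exact setLIntegral_mono' hVm hK2
    _ = c * (A ^ (k - 1) * A) := by
        rw [lintegral_const_mul' _ _ ENNReal.coe_ne_top]
        ring
    _ = c * A ^ k := by
        congr 1
        conv_lhs => rw [← ENNReal.rpow_one A, ← ENNReal.rpow_mul,
          ← ENNReal.rpow_add_of_nonneg _ _ (by linarith) zero_le_one]
        congr 1
        ring

/-- The Hardy inequality on homogeneous domains of positivity. -/
theorem IsDomainOfPositivity.exists_hardy_inequality (hV : IsDomainOfPositivity V S)
    (hS : S.PosDef) (hhom : IsHomogeneous V) {p q γ : ℝ} (hp : 1 ≤ p) (hpq : p ≤ q)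
    (hγ : γ < -sigma V * (q * (1 - 1 / p)) - sigma (dualCone V) + q / p - 2) :
    ∃ c : ℝ≥0, ∀ f : E n → ℝ≥0∞, AEMeasurable f (volume.restrict V) →
      (∫⁻ x in V, coneDelta V x ^ (γ - q) * hardy V f x ^ q) ^ (1 / q)
        ≤ c * (∫⁻ x in V, f x ^ p * coneDelta V x ^ ((γ + 1) * p / q - 1)) ^ (1 / p) := by
  have hP := hV.isProperCone hS
  have hVm := hP.isOpen.measurableSet
  have hΔ := measurable_coneDelta hP.isOpen
  have hp0 : 0 < p := by linarith
  have hq0 : 0 < q := by linarith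
  -- The upper bound is what Hölder on `⟨0, x⟩` needs, the lower one what integrability above `t`
  -- needs; the hypothesis on `γ` says that the gap is nonempty.
  obtain ⟨δ, hδ1, hδ2⟩ : ∃ δ, (γ - q / p + sigma (dualCone V) + 2) / q < δ ∧
      δ < -sigma V * (1 - 1 / p) := by
    refine exists_between ?_
    rw [div_lt_iff₀ hq0]
    linarith
  rw [div_lt_iff₀ hq0] at hδ1
  obtain ⟨c₁, hc₁⟩ := exists_hardy_rpow_le hP hhom hV.nonempty hp hδ2
  set k := q / p with hkdef
  have hk : 1 ≤ k := (one_le_div hp0).2 hpq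
  have hk0 : 0 < k := by linarith
  have hkp : p * k = q := mul_div_cancel₀ _ hp0.ne'
  -- Makes `f ^ p Δ_V ^ (δp) Δ_V ^ (-η)` the integrand of the right-hand side.
  set η := -((γ + 1) * p / q - 1 - δ * p) with hη
  have hkη : -k * η - 1 = γ - q + (p - 1 - δ * p) * k := by
    have : k * ((γ + 1) * p / q) = γ + 1 := by rw [hkdef]; field_simp
    rw [hη]
    linear_combination this - hkp
  obtain ⟨c₂, hc₂⟩ := hV.exists_setLIntegral_hardy_rpow_le hS hhom hk (η := η) (by
    rw [hkη]
    have : (p - 1 - δ * p) * k = q - k - δ * q := by linear_combination (1 - δ) * hkp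
    rw [this]; linarith)
  refine ⟨(c₁ ^ k * c₂) ^ (1 / q), fun f hf => ?_⟩
  set g : E n → ℝ≥0∞ := fun t => f t ^ p * coneDelta V t ^ (δ * p) with hg
  have hgm : AEMeasurable g (volume.restrict V) :=
    (hf.pow_const p).mul (hΔ.pow_const _).aemeasurable
  have hgA : ∫⁻ t in V, g t * coneDelta V t ^ (-η)
      = ∫⁻ x in V, f x ^ p * coneDelta V x ^ ((γ + 1) * p / q - 1) := by
    refine setLIntegral_congr_fun hVm fun t ht => ?_
    simp only [hg]
    rw [mul_assoc, hP.rpow_add ht, hη]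
    congr 2
    ring
  have hmain : ∫⁻ x in V, coneDelta V x ^ (γ - q) * hardy V f x ^ q
      ≤ (c₁ ^ k * c₂ : ℝ≥0) * (∫⁻ x in V, f x ^ p * coneDelta V x ^ ((γ + 1) * p / q - 1)) ^ k := by
    rw [← hgA]
    calc _ ≤ ∫⁻ x in V, (c₁ ^ k : ℝ≥0) * (coneDelta V x ^ (-k * η - 1) * hardy V g x ^ k) := by
          refine setLIntegral_mono' hVm fun x hx => ?_
          rw [← hkp, ENNReal.rpow_mul, hkη, hkp, ← hP.rpow_add hx, ENNReal.rpow_mul _ _ k]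
          calc _ ≤ coneDelta V x ^ (γ - q)
                * (c₁ * coneDelta V x ^ (p - 1 - δ * p) * hardy V g x) ^ k := by
                gcongr _ * ?_
                exact ENNReal.rpow_le_rpow (hc₁ f hf x hx) hk0.le
            _ = _ := by
              rw [ENNReal.mul_rpow_of_nonneg _ _ hk0.le, ENNReal.mul_rpow_of_nonneg _ _ hk0.le,
                ENNReal.coe_rpow_of_nonneg _ hk0.le]
              ring
      _ ≤ _ := by
          rw [lintegral_const_mul' _ _ ENNReal.coe_ne_top, ENNReal.coe_mul, mul_assoc]
          gcongr
          exact hc₂ g hgm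
  calc _ ≤ _ := ENNReal.rpow_le_rpow hmain (by positivity)
    _ = _ := by
      rw [ENNReal.mul_rpow_of_nonneg _ _ (by positivity),
        ENNReal.coe_rpow_of_nonneg _ (by positivity), ← ENNReal.rpow_mul]
      congr 2
      rw [hkdef]; field_simp

/-! ### Riemann-Liouville operators -/

theorem riemannLiouville_one (V : Set (E n)) (f : E n → ℝ≥0∞) (x : E n) :
    riemannLiouville V 1 f x = hardy V f x := by
  simp [riemannLiouville, hardy]

/-- Since `x - (x - t) = t ∈ V`, monotonicity gives `Δ_V(x - t) ≤ Δ_V(x)`, and `r - 1 ≥ 0` keeps the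
direction. -/
theorem IsProperCone.riemannLiouville_le (hV : IsProperCone V) {r : ℝ} (hr : 1 ≤ r)
    (f : E n → ℝ≥0∞) (x : E n) :
    riemannLiouville V r f x
      ≤ ENNReal.ofReal (1 / Real.Gamma r) * (coneDelta V x ^ (r - 1) * hardy V f x) := by
  rw [riemannLiouville, hardy]
  gcongr
  rw [← lintegral_const_mul' _ _
    (ENNReal.rpow_ne_top_of_nonneg (by linarith) (hV.coneDelta_ne_top x))]
  refine setLIntegral_mono' (isOpen_coneInterval hV.isOpen x).measurableSet fun t ht => ?_
  gcongr ?_ * _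
  refine ENNReal.rpow_le_rpow (hV.coneDelta_mono ?_) (by linarith)
  simpa using ht.1

theorem IsDomainOfPositivity.exists_riemannLiouville_inequality (hV : IsDomainOfPositivity V S)
    (hS : S.PosDef) (hhom : IsHomogeneous V) {r p q γ : ℝ} (hr : 1 ≤ r) (hp : 1 ≤ p) (hpq : p ≤ q)
    (hγ : γ < -sigma V * (q * (1 - 1 / p)) - sigma (dualCone V) + q * (1 / p - r + 1) - 2) :
    ∃ c : ℝ≥0, ∀ f : E n → ℝ≥0∞, AEMeasurable f (volume.restrict V) →
      (∫⁻ x in V, coneDelta V x ^ (γ - q) * riemannLiouville V r f x ^ q) ^ (1 / q)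
        ≤ c * (∫⁻ x in V, f x ^ p *
            coneDelta V x ^ ((r - 1) * p + (γ + 1) * p / q - 1)) ^ (1 / p) := by
  have hP := hV.isProperCone hS
  have hVm := hP.isOpen.measurableSet
  have hq0 : 0 < q := by linarith
  -- The shift of `γ` absorbs the `q`-th power of the factor `Δ_V ^ (r - 1)`.
  obtain ⟨c, hc⟩ := hV.exists_hardy_inequality hS hhom hp hpq (γ := γ + (r - 1) * q) (by
    have : q * (1 / p - r + 1) = q / p - (r - 1) * q := by ring
    linarith)
  set d : ℝ≥0 := (1 / Real.Gamma r).toNNReal with hd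
  refine ⟨d * c, fun f hf => ?_⟩
  have hexp : (γ + (r - 1) * q + 1) * p / q - 1 = (r - 1) * p + (γ + 1) * p / q - 1 := by
    field_simp
    ring
  have hcf := hc f hf
  rw [hexp] at hcf
  have hmain : ∫⁻ x in V, coneDelta V x ^ (γ - q) * riemannLiouville V r f x ^ q
      ≤ (d ^ q : ℝ≥0) *
        ∫⁻ x in V, coneDelta V x ^ (γ + (r - 1) * q - q) * hardy V f x ^ q := by
    rw [← lintegral_const_mul' _ _ ENNReal.coe_ne_top]
    refine setLIntegral_mono' hVm fun x hx => ?_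
    calc _ ≤ coneDelta V x ^ (γ - q) * (d * (coneDelta V x ^ (r - 1) * hardy V f x)) ^ q := by
          gcongr _ * ?_
          exact ENNReal.rpow_le_rpow (hP.riemannLiouville_le hr f x) hq0.le
      _ = (d ^ q : ℝ≥0) * (coneDelta V x ^ (γ - q) * coneDelta V x ^ ((r - 1) * q)
            * hardy V f x ^ q) := by
          rw [ENNReal.mul_rpow_of_nonneg _ _ hq0.le, ENNReal.mul_rpow_of_nonneg _ _ hq0.le,
            ENNReal.coe_rpow_of_nonneg _ hq0.le, ← ENNReal.rpow_mul]
          ring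
      _ = _ := by
          rw [hP.rpow_add hx, show γ - q + (r - 1) * q = γ + (r - 1) * q - q by ring]
  calc _ ≤ _ := ENNReal.rpow_le_rpow hmain (by positivity)
    _ = d * (∫⁻ x in V, coneDelta V x ^ (γ + (r - 1) * q - q) * hardy V f x ^ q) ^ (1 / q) := by
      rw [ENNReal.mul_rpow_of_nonneg _ _ (by positivity), ENNReal.coe_rpow_of_nonneg _ hq0.le,
        ← ENNReal.rpow_mul, mul_one_div_cancel hq0.ne', ENNReal.rpow_one]
    _ ≤ _ := by
      rw [ENNReal.coe_mul, mul_assoc]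
      gcongr

theorem IsProperCone.rpow_mul_riemannLiouville_le (hV : IsProperCone V) {r : ℝ} (hr : 1 ≤ r)
    (α : ℝ) (f : E n → ℝ≥0∞) {x : E n} (hx : x ∈ V) :
    coneDelta V x ^ (-1 + α) * riemannLiouville V r f x
      ≤ ENNReal.ofReal (1 / Real.Gamma r) * (coneDelta V x ^ (α + r - 2) * hardy V f x) := by
  calc _ ≤ coneDelta V x ^ (-1 + α) *
        (ENNReal.ofReal (1 / Real.Gamma r) * (coneDelta V x ^ (r - 1) * hardy V f x)) := by
        gcongr; exact hV.riemannLiouville_le hr f x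
    _ = ENNReal.ofReal (1 / Real.Gamma r) *
        (coneDelta V x ^ (-1 + α) * coneDelta V x ^ (r - 1) * hardy V f x) := by ring
    _ = _ := by
      rw [hV.rpow_add hx]
      congr 3
      ring

theorem IsProperCone.exists_essSup_le_lintegral (hV : IsProperCone V) (hhom : IsHomogeneous V)
    (hne : V.Nonempty) {r p α : ℝ} (hr : 1 ≤ r) (hp : 1 ≤ p)
    (hα : α < 2 - (1 + sigma V) * (1 - 1 / p) - r) :
    ∃ c : ℝ≥0, ∀ f : E n → ℝ≥0∞, AEMeasurable f (volume.restrict V) →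
      essSup (fun x => coneDelta V x ^ (-1 + α) *
          riemannLiouville V r (fun t => f t * coneDelta V t ^ (-α)) x) (volume.restrict V)
        ≤ c * (∫⁻ x in V, f x ^ p * coneDelta V x ^ ((r - 1) * p - 1)) ^ (1 / p) := by
  have hVm := hV.isOpen.measurableSet
  have hΔ := measurable_coneDelta hV.isOpen
  have hp0 : 0 < p := by linarith
  -- With this `δ`, `(f Δ_V ^ (-α)) ^ p Δ_V ^ (δp)` equals `f ^ p Δ_V ^ ((r - 1)p - 1)`, and the
  -- bound on `α` is the one required of `δ`.
  obtain ⟨c, hc⟩ := exists_hardy_rpow_le hV hhom hne hp (δ := α + r - 1 - 1 / p) (by linarith)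
  have hδp : (α + r - 1 - 1 / p) * p = (α + r - 1) * p - 1 := by field_simp
  set d : ℝ≥0 := (1 / Real.Gamma r).toNNReal
  refine ⟨d * c ^ (1 / p), fun f hf => ?_⟩
  set A := ∫⁻ x in V, f x ^ p * coneDelta V x ^ ((r - 1) * p - 1) with hA
  refine essSup_le_of_ae_le _ ((ae_restrict_iff' hVm).2 (Filter.Eventually.of_forall
    fun x hx => ?_))
  refine (hV.rpow_mul_riemannLiouville_le hr α _ hx).trans ?_
  set F : E n → ℝ≥0∞ := fun t => f t * coneDelta V t ^ (-α) with hF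
  have h1 := hc F (hf.mul (hΔ.pow_const _).aemeasurable) x hx
  have h2 : ∫⁻ t in coneInterval V 0 x, F t ^ p * coneDelta V t ^ ((α + r - 1 - 1 / p) * p) ≤ A := by
    refine le_trans (le_of_eq ?_) (lintegral_mono_set (coneInterval_subset V x))
    refine setLIntegral_congr_fun (isOpen_coneInterval hV.isOpen x).measurableSet fun t ht => ?_
    simp only [hF]
    rw [ENNReal.mul_rpow_of_nonneg _ _ hp0.le, ← ENNReal.rpow_mul, mul_assoc, hV.rpow_add ht.1, hδp]
    congr 2
    ring
  have h3 : hardy V F x ≤ (c ^ (1 / p) : ℝ≥0) * coneDelta V x ^ (2 - α - r) * A ^ (1 / p) := by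
    calc hardy V F x = (hardy V F x ^ p) ^ (1 / p) := by
          rw [← ENNReal.rpow_mul, mul_one_div_cancel hp0.ne', ENNReal.rpow_one]
      _ ≤ (c * coneDelta V x ^ ((2 - α - r) * p) * A) ^ (1 / p) := by
          refine ENNReal.rpow_le_rpow (h1.trans ?_) (by positivity)
          rw [hδp]
          rw [hδp] at h2
          have : p - 1 - ((α + r - 1) * p - 1) = (2 - α - r) * p := by ring
          rw [this]
          gcongr
      _ = _ := by
          rw [ENNReal.mul_rpow_of_nonneg _ _ (by positivity),
            ENNReal.mul_rpow_of_nonneg _ _ (by positivity), ← ENNReal.rpow_mul,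
            mul_assoc (2 - α - r), mul_one_div_cancel hp0.ne', mul_one,
            ENNReal.coe_rpow_of_nonneg _ (by positivity)]
  calc _ ≤ (d : ℝ≥0∞) * (coneDelta V x ^ (α + r - 2) *
        ((c ^ (1 / p) : ℝ≥0) * coneDelta V x ^ (2 - α - r) * A ^ (1 / p))) := by
        gcongr
        exact le_rfl
    _ = d * (c ^ (1 / p) : ℝ≥0) * (coneDelta V x ^ (α + r - 2) * coneDelta V x ^ (2 - α - r))
        * A ^ (1 / p) := by ring
    _ = _ := by
      rw [hV.rpow_add hx, show α + r - 2 + (2 - α - r) = 0 by ring, ENNReal.rpow_zero, mul_one,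
        ENNReal.coe_mul]

/-- If `f Δ_V ^ (r - 1) ≤ M`, then `f Δ_V ^ (-α) ≤ M Δ_V ^ (1 - α - r)`, whose exponent exceeds
`σ(V)`; its integral over `⟨0, x⟩` cancels the outer power. -/
theorem IsProperCone.exists_essSup_le_essSup (hV : IsProperCone V) (hhom : IsHomogeneous V)
    (hne : V.Nonempty) {r α : ℝ} (hr : 1 ≤ r) (hα : α < 1 - r - sigma V) :
    ∃ c : ℝ≥0, ∀ f : E n → ℝ≥0∞,
      essSup (fun x => coneDelta V x ^ (-1 + α) *
          riemannLiouville V r (fun t => f t * coneDelta V t ^ (-α)) x) (volume.restrict V)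
        ≤ c * essSup (fun x => f x * coneDelta V x ^ (r - 1)) (volume.restrict V) := by
  have hVm := hV.isOpen.measurableSet
  have hΔ := measurable_coneDelta hV.isOpen
  obtain ⟨c, hc⟩ := exists_setLIntegral_coneInterval_le hV hhom hne
    (α := 1 - α - r) (by linarith)
  set d : ℝ≥0 := (1 / Real.Gamma r).toNNReal
  refine ⟨d * c, fun f => ?_⟩
  set M := essSup (fun x => f x * coneDelta V x ^ (r - 1)) (volume.restrict V)
  have hM : ∀ᵐ t, t ∈ V → f t * coneDelta V t ^ (r - 1) ≤ M :=
    (ae_restrict_iff' hVm).1 (ENNReal.ae_le_essSup _)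
  refine essSup_le_of_ae_le _ ((ae_restrict_iff' hVm).2 (Filter.Eventually.of_forall
    fun x hx => ?_))
  refine (hV.rpow_mul_riemannLiouville_le hr α _ hx).trans ?_
  have h3 : hardy V (fun t => f t * coneDelta V t ^ (-α)) x
      ≤ M * (c * coneDelta V x ^ (2 - α - r)) := by
    calc _ ≤ ∫⁻ t in coneInterval V 0 x, M * coneDelta V t ^ (1 - α - r) := by
          refine setLIntegral_mono_ae' (isOpen_coneInterval hV.isOpen x).measurableSet ?_
          filter_upwards [hM] with t hMt ht
          calc f t * coneDelta V t ^ (-α)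
              = f t * coneDelta V t ^ (r - 1) * coneDelta V t ^ (1 - α - r) := by
                rw [mul_assoc, hV.rpow_add ht.1]
                congr 2
                ring
            _ ≤ _ := by gcongr; exact hMt ht.1
      _ = M * ∫⁻ t in coneInterval V 0 x, coneDelta V t ^ (1 - α - r) :=
          lintegral_const_mul _ (hΔ.pow_const _)
      _ ≤ _ := by
          gcongr
          refine (hc x hx).trans (le_of_eq ?_)
          congr 2
          ring
  calc _ ≤ (d : ℝ≥0∞) * (coneDelta V x ^ (α + r - 2) *
        (M * (c * coneDelta V x ^ (2 - α - r)))) := by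
        gcongr
        exact le_rfl
    _ = d * c * (coneDelta V x ^ (α + r - 2) * coneDelta V x ^ (2 - α - r)) * M := by ring
    _ = _ := by
      rw [hV.rpow_add hx, show α + r - 2 + (2 - α - r) = 0 by ring, ENNReal.rpow_zero, mul_one,
        ENNReal.coe_mul]

end ConeRL

/-- In all bounds `c` is a finite constant which does not depend on `f`, and `1 / p'` is written
as `1 - 1 / p`. -/
theorem theorem3p13 {n : ℕ} (V : Set (ConeRL.E n)) (S : Matrix (Fin n) (Fin n) ℝ)
    (hV : ConeRL.IsDomainOfPositivity V S) (hS : S.PosDef) (hhom : ConeRL.IsHomogeneous V) :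
    (∀ r : ℝ, 1 ≤ r →
      (∀ p q γ : ℝ, 1 ≤ p → p ≤ q →
        γ < -ConeRL.sigma V * (q * (1 - 1 / p)) - ConeRL.sigma (ConeRL.dualCone V)
            + q * (1 / p - r + 1) - 2 →
        ∃ c : ℝ≥0, ∀ f : ConeRL.E n → ℝ≥0∞, AEMeasurable f (volume.restrict V) →
          (∫⁻ x in V, ConeRL.coneDelta V x ^ (γ - q) *
              ConeRL.riemannLiouville V r f x ^ q) ^ (1 / q)
            ≤ c * (∫⁻ x in V, f x ^ p *
                ConeRL.coneDelta V x ^ ((r - 1) * p + (γ + 1) * p / q - 1)) ^ (1 / p)) ∧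
      (∀ p α : ℝ, 1 ≤ p →
        α < 2 - (1 + ConeRL.sigma V) * (1 - 1 / p) - r →
        ∃ c : ℝ≥0, ∀ f : ConeRL.E n → ℝ≥0∞, AEMeasurable f (volume.restrict V) →
          essSup (fun x => ConeRL.coneDelta V x ^ (-1 + α) *
              ConeRL.riemannLiouville V r (fun t => f t * ConeRL.coneDelta V t ^ (-α)) x)
              (volume.restrict V)
            ≤ c * (∫⁻ x in V, f x ^ p *
                ConeRL.coneDelta V x ^ ((r - 1) * p - 1)) ^ (1 / p)) ∧
      (∀ α : ℝ, α < 1 - r - ConeRL.sigma V →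
        ∃ c : ℝ≥0, ∀ f : ConeRL.E n → ℝ≥0∞, AEMeasurable f (volume.restrict V) →
          essSup (fun x => ConeRL.coneDelta V x ^ (-1 + α) *
              ConeRL.riemannLiouville V r (fun t => f t * ConeRL.coneDelta V t ^ (-α)) x)
              (volume.restrict V)
            ≤ c * essSup (fun x => f x * ConeRL.coneDelta V x ^ (r - 1))
                (volume.restrict V))) ∧
    -- the case `r = 1`: the Riemann-Liouville operator is Hardy's operator, which is bounded
    (∀ (f : ConeRL.E n → ℝ≥0∞), ∀ x ∈ V,
        ConeRL.riemannLiouville V 1 f x = ConeRL.hardy V f x) ∧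
    (∀ p q γ : ℝ, 1 ≤ p → p ≤ q →
      γ < -ConeRL.sigma V * (q * (1 - 1 / p)) - ConeRL.sigma (ConeRL.dualCone V) + q / p - 2 →
      ∃ c : ℝ≥0, ∀ f : ConeRL.E n → ℝ≥0∞, AEMeasurable f (volume.restrict V) →
        (∫⁻ x in V, ConeRL.coneDelta V x ^ (γ - q) * ConeRL.hardy V f x ^ q) ^ (1 / q)
          ≤ c * (∫⁻ x in V, f x ^ p *
              ConeRL.coneDelta V x ^ ((γ + 1) * p / q - 1)) ^ (1 / p)) := by
  have hP := hV.isProperCone hS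
  refine ⟨fun r hr => ⟨fun p q γ hp hpq hγ => ?_, fun p α hp hα => ?_, fun α hα => ?_⟩,
    fun f x _ => ConeRL.riemannLiouville_one V f x, fun p q γ hp hpq hγ => ?_⟩
  · exact hV.exists_riemannLiouville_inequality hS hhom hr hp hpq hγ
  · exact hP.exists_essSup_le_lintegral hhom hV.nonempty hr hp hα
  · obtain ⟨c, hc⟩ := hP.exists_essSup_le_essSup hhom hV.nonempty hr hα
    exact ⟨c, fun f _ => hc f⟩
  · exact hV.exists_hardy_inequality hS hhom hp hpq hγ
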